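/- **Proposition (Odd local contrast for the sign-symmetrized family).** Let $C$ be a random finite simple counting measure on $\mathbb{R}$ with $C(\{0\})=1$ a.s., $\mathrm{supp}(C)\subset[0,\infty)$ a.s. and $\mathbb{E}[C(\mathbb{R})^3]<\infty$. Let $\{U_j\}$ be a homogeneous Poisson process on $\mathbb{R}$ with rate $\nu>0$, independent of i.i.d. copies $\{C_j\}$ of $C$. For each $\theta\in[-1,1]$ let $\{S_{j,\theta}\}_j$ be i.i.d. signs with $\mathbb{P}(S_{j,\theta}=\pm1)=\tfrac{1\pm\theta}{2}$, independent of $\{U_j,C_j\}_j$, and let $$N_\theta:=\sum_j\vartheta_{U_j}(S_{j,\theta}C_j),$$ where $s\mu$ is the pushforward of $\mu$ under $x\mapsto sx$ and $\vartheta_u\mu$ is the translate of $\mu$ by $u$. Write $\mathbb{E}_\theta$ for expectation under the law of $N_\theta$. For a point process $N$ let $\alpha_n(f_0,\dots,f_{n-1})=\mathbb{E}\sum^{\neq}_{x_0,\dots,x_{n-1}\in N}\prod_i f_i(x_i)$ be its factorial moments (sums over ordered tuples of pairwise distinct points), and let its third factorial cumulant be $$\begin{aligned}\kappa_3(f_0,f_1,f_2)={}&\alpha_3(f_0,f_1,f_2)-\alpha_2(f_0,f_1)\alpha_1(f_2)-\alpha_2(f_0,f_2)\alpha_1(f_1)\\&-\alpha_2(f_1,f_2)\alpha_1(f_0)+2\alpha_1(f_0)\alpha_1(f_1)\alpha_1(f_2).\end{aligned}$$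 Assume that the reduced third factorial cumulant of $N_1$ has a density $c_{3,1}\in L^1(\mathbb{R}^2)$, i.e. that for $N=N_1$ and all bounded, compactly supported Borel functions $f_0,f_1,f_2$, $$\kappa_3(f_0,f_1,f_2)=\int_{\mathbb{R}}\iint_{\mathbb{R}^2}f_0(t)f_1(t+\tau_1)f_2(t+\tau_2)\,c_{3,1}(\tau_1,\tau_2)\,d\tau_1d\tau_2\,dt.$$ Put $c_3^{\mathrm o}(\tau):=\tfrac12\big(c_{3,1}(\tau)-c_{3,1}(-\tau)\big)$ and $B_1(\omega):=\iint_{\mathbb{R}^2} c_{3,1}(\tau)e^{-i\omega\cdot\tau}\,d\tau$. Let $g:\mathbb{R}^2\to\mathbb{R}$ be bounded Borel, compactly supported and jointly odd, $g(-\tau)=-g(\tau)$, and for $T>0$ put $$\mathcal O_{T,g}:=\frac1T\sum^{\neq}_{x_0,x_1,x_2\in N\cap[0,T]}g(x_1-x_0,x_2-x_0).$$ Then: 1. For every $T>0$ and $\theta\in[-1,1]$, $\mathcal O_{T,g}$ is integrable under the law of $N_\theta$ and $\mathbb{E}_\theta[\mathcal O_{T,g}]=\theta\,\mu_{T,g}$,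 where $$\mu_{T,g}=\frac1T\int_0^T\iint_{\mathbb{R}^2}g(\tau_1,\tau_2)\,\mathbf 1_{\{0\le x_0+\tau_1\le T,\ 0\le x_0+\tau_2\le T\}}\,c_3^{\mathrm o}(\tau_1,\tau_2)\,d\tau_1d\tau_2\,dx_0.$$ 2. As $T\to\infty$, $\mu_{T,g}=\mu_g+O(T^{-1})$, where $\mu_g:=\iint_{\mathbb{R}^2}g(\tau)\,c_3^{\mathrm o}(\tau)\,d\tau$. 3. If $\widehat g=iH_g$ with $H_g$ real-valued and integrable, where $\widehat g(\omega):=\iint_{\mathbb{R}^2} e^{-i\omega\cdot\tau}g(\tau)\,d\tau$, then $$\mu_g=\frac1{(2\pi)^2}\iint_{\mathbb{R}^2}H_g(\omega_1,\omega_2)\,\mathrm{Im}\,B_1(\omega_1,\omega_2)\,d\omega_1d\omega_2.$$ -/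

import Mathlib

open MeasureTheory ProbabilityTheory Set Filter Asymptotics
open scoped NNReal ENNReal

noncomputable section

namespace ClusterContrast

variable {Ω : Type*} [MeasurableSpace Ω]

/-! ### Point configurations and sums over distinct points -/

/-- The points (atoms) of a counting measure on the line. -/
def points (μ : Measure ℝ) : Set ℝ := {x | μ {x} ≠ 0}

/-- A finite simple counting measure: a finite sum of unit point masses at distinct points. -/
def IsFiniteSimpleCounting (μ : Measure ℝ) : Prop :=
  ∃ s : Finset ℝ, μ = ∑ x ∈ s, Measure.dirac x

/-- The sum of `F` over ordered `n`-tuples of pairwise distinct elements of `A`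
(injections `Fin n ↪ A`). -/
def sumDistinct {n : ℕ} (A : Set ℝ) (F : (Fin n → ℝ) → ℝ) : ℝ :=
  ∑' x : Fin n ↪ A, F (fun i => (x i : ℝ))

/-- Bounded compactly supported Borel functions. -/
structure IsTestFunction {X : Type*} [TopologicalSpace X] [MeasurableSpace X]
    (f : X → ℝ) : Prop where
  measurable : Measurable f
  bounded : ∃ M : ℝ, ∀ x, |f x| ≤ M
  compactSupport : HasCompactSupport f

/-! ### Factorial moments and factorial cumulants of a point process -/

/-- The `n`-th factorial moment measure of the point process `N`, tested against the product
`f 0 ⊗ ⋯ ⊗ f (n - 1)`: the mean of the sum of `∏ i, f i (x i)` over ordered `n`-tuples of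
pairwise distinct points of `N`. -/
def factorialMoment (P : Measure Ω) (N : Ω → Measure ℝ) {n : ℕ} (f : Fin n → ℝ → ℝ) : ℝ :=
  ∫ ω, sumDistinct (points (N ω)) (fun x : Fin n → ℝ => ∏ i, f i (x i)) ∂P

/-- The third factorial cumulant measure of `N`, tested against `f 0 ⊗ f 1 ⊗ f 2`: the third
mixed derivative at the origin of the logarithm of the factorial moment generating functional,
written out through the factorial moments. -/
def factorialCumulant3 (P : Measure Ω) (N : Ω → Measure ℝ) (f : Fin 3 → ℝ → ℝ) : ℝ :=
  factorialMoment P N ![f 0, f 1, f 2]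
    - factorialMoment P N ![f 0, f 1] * factorialMoment P N ![f 2]
    - factorialMoment P N ![f 0, f 2] * factorialMoment P N ![f 1]
    - factorialMoment P N ![f 1, f 2] * factorialMoment P N ![f 0]
    + 2 * factorialMoment P N ![f 0] * factorialMoment P N ![f 1] * factorialMoment P N ![f 2]

/-- `c` is an integrable density of the reduced third factorial cumulant measure of `N`. -/
structure IsReducedCumulantDensity3 (P : Measure Ω) (N : Ω → Measure ℝ) (c : ℝ × ℝ → ℝ) :
    Prop where
  integrable : Integrable c
  disintegration : ∀ f : Fin 3 → ℝ → ℝ, (∀ i, IsTestFunction (f i)) →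
    factorialCumulant3 P N f =
      ∫ t : ℝ, ∫ τ : ℝ × ℝ, f 0 t * f 1 (t + τ.1) * f 2 (t + τ.2) * c τ

/-! ### The sign-symmetrized Poisson cluster family -/

/-- The random points `U 0, U 1, …` form a homogeneous Poisson process on the line with
rate `ν`. -/
structure IsPoissonProcess (P : Measure Ω) (ν : ℝ≥0) (U : ℕ → Ω → ℝ) : Prop where
  measurable : ∀ j, Measurable (U j)
  law : ∀ A : Set ℝ, MeasurableSet A → volume A ≠ ∞ →
    P.map (fun ω => Measure.sum (fun j => Measure.dirac (U j ω)) A) =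
      (poissonMeasure (ν * (volume A).toNNReal)).map (fun k : ℕ => (k : ℝ≥0∞))
  indep : ∀ (n : ℕ) (A : Fin n → Set ℝ), (∀ i, MeasurableSet (A i)) →
    Pairwise (fun i j => Disjoint (A i) (A j)) →
    iIndepFun (fun i ω => Measure.sum (fun j => Measure.dirac (U j ω)) (A i)) P

/-- `Q` is the law of a random finite simple counting measure `C` on the line with `C({0}) = 1`,
`C` carried by `[0, ∞)`, and total mass having a finite third moment. -/
structure IsClusterLaw (Q : Measure (Measure ℝ)) : Prop where
  isProbability : IsProbabilityMeasure Q
  finiteSimple : ∀ᵐ μ ∂Q, IsFiniteSimpleCounting μ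
  rooted : ∀ᵐ μ ∂Q, μ {0} = 1
  forward : ∀ᵐ μ ∂Q, μ (Iio 0) = 0
  thirdMoment : ∫⁻ μ, (μ univ) ^ 3 ∂Q < ∞

/-- The data of the sign-symmetrized family: Poisson immigrants `U` of rate `ν`, independent of
i.i.d. clusters `C j` of law `Q`, and, for each `θ ∈ [-1, 1]`, i.i.d. signs `S θ j`
independent of `(U, C)` with `P(S = ±1) = (1 ± θ) / 2`. -/
structure IsSignSymmetrizedFamily (P : Measure Ω) (ν : ℝ≥0) (Q : Measure (Measure ℝ))
    (U : ℕ → Ω → ℝ) (C : ℕ → Ω → Measure ℝ) (S : ℝ → ℕ → Ω → ℝ) : Prop where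
  rate_pos : 0 < ν
  poisson : IsPoissonProcess P ν U
  clusterLaw : IsClusterLaw Q
  measurable_cluster : ∀ j, Measurable (C j)
  law_cluster : ∀ j, P.map (C j) = Q
  indep_clusters : iIndepFun C P
  indep_immigrants_clusters : IndepFun (fun ω j => U j ω) (fun ω j => C j ω) P
  measurable_sign : ∀ θ ∈ Icc (-1 : ℝ) 1, ∀ j, Measurable (S θ j)
  sign_pos : ∀ θ ∈ Icc (-1 : ℝ) 1, ∀ j, P {ω | S θ j ω = 1} = ENNReal.ofReal ((1 + θ) / 2)
  sign_neg : ∀ θ ∈ Icc (-1 : ℝ) 1, ∀ j, P {ω | S θ j ω = -1} = ENNReal.ofReal ((1 - θ) / 2)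
  indep_signs : ∀ θ ∈ Icc (-1 : ℝ) 1, iIndepFun (S θ) P
  indep_signs_rest : ∀ θ ∈ Icc (-1 : ℝ) 1,
    IndepFun (fun ω j => S θ j ω) (fun ω => ((fun j => U j ω), (fun j => C j ω))) P

/-- The process `N_θ`: the superposition over `j` of the clusters `S θ j • C j`, each translated
by its immigrant `U j`. -/
def signedClusterProcess (U : ℕ → Ω → ℝ) (C : ℕ → Ω → Measure ℝ) (S : ℝ → ℕ → Ω → ℝ)
    (θ : ℝ) (ω : Ω) : Measure ℝ :=
  Measure.sum fun j => ((C j ω).map (fun x => S θ j ω * x)).map (fun x => x + U j ω)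

/-! ### The odd contrast -/

/-- The finite-window statistic: `T⁻¹` times the sum of `g (x₁ - x₀, x₂ - x₀)` over ordered
triples of pairwise distinct points in `[0, T]`. -/
def oddStatistic (T : ℝ) (g : ℝ × ℝ → ℝ) (μ : Measure ℝ) : ℝ :=
  1 / T * sumDistinct (points μ ∩ Icc 0 T) (fun x : Fin 3 → ℝ => g (x 1 - x 0, x 2 - x 0))

/-- The odd part of a function on the plane. -/
def oddPart (c : ℝ × ℝ → ℝ) (τ : ℝ × ℝ) : ℝ := (c τ - c (-τ)) / 2

/-- The finite-window contrast `μ_{T,g}`. -/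
def windowContrast (c : ℝ × ℝ → ℝ) (g : ℝ × ℝ → ℝ) (T : ℝ) : ℝ :=
  1 / T * ∫ x₀ in (0 : ℝ)..T, ∫ τ : ℝ × ℝ,
    g τ * indicator {τ : ℝ × ℝ | x₀ + τ.1 ∈ Icc 0 T ∧ x₀ + τ.2 ∈ Icc 0 T} 1 τ * oddPart c τ

/-- The limiting contrast `μ_g`. -/
def limitContrast (c : ℝ × ℝ → ℝ) (g : ℝ × ℝ → ℝ) : ℝ :=
  ∫ τ : ℝ × ℝ, g τ * oddPart c τ

/-- The Fourier transform `∬ f(τ) exp(-i ω·τ) dτ`; applied to the reduced third factorial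
cumulant density it is the factorial bispectrum. -/
def planeFourier (f : ℝ × ℝ → ℝ) (ω : ℝ × ℝ) : ℂ :=
  ∫ τ : ℝ × ℝ, Complex.exp (-Complex.I * ((ω.1 * τ.1 + ω.2 * τ.2 : ℝ) : ℂ)) * (f τ : ℂ)

end ClusterContrast

end

/-!
The factorial moments of a Poisson point process are the powers of its intensity, so the factorial
moments of `N_θ` expand over set partitions into products of *cluster cumulant measures*: the
immigrant and its cluster are integrated over Lebesgue measure and the cluster law, against the
ordered tuples of points of a single cluster. Hence the third factorial cumulant of `N_θ` is the
third cluster cumulant measure. As a cluster with sign `-1` is the reflection of a cluster with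
sign `1`, this measure is the mixture, with weights `(1 ± θ) / 2`, of that of `N_1` and of its
reflection.

The summand `F (x₀, x₁, x₂) = g (x₁ - x₀, x₂ - x₀) 1_{[0,T]³}` is odd under the reflection
`x ↦ T - x` of all three points. The lower-order terms of the third moment measure are built from
the first and second cluster cumulant measures. These are invariant under the reflection, the
second one because it is stationary and exchangeable, so `F` integrates to zero against them. The
mixture then integrates `F` to `θ` times the value at `θ = 1`, and uniqueness of a measure with
given integrals of products identifies that value with an integral against `c`.

Only immigrants within a bounded distance of the ends of `[0, T]` see the window, which gives the
rate `1 / T`. The bispectral formula is Fourier inversion for `g`: against a purely imaginary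
transform only the imaginary part of the bispectrum survives.
-/

noncomputable section

namespace ClusterContrast

/-! ### Factorial moment measures of a Poisson process -/

theorem prod_tsum_eq_tsum_prod {ι : Type*} {n : ℕ} (f : Fin n → ι → ℝ≥0∞) :
    ∏ k, ∑' j, f k j = ∑' e : Fin n → ι, ∏ k, f k (e k) := by
  induction n with
  | zero => simp
  | succ n ih =>
    rw [Fin.prod_univ_succ, ih, ← (Fin.consEquiv fun _ : Fin (n + 1) => ι).tsum_eq,
      ENNReal.tsum_prod', ← ENNReal.tsum_mul_right]
    congr 1 with j
    rw [← ENNReal.tsum_mul_left]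
    congr 1 with e
    simp [Fin.prod_univ_succ, Fin.consEquiv]

section PoissonLaw

variable (r : ℝ≥0)

theorem lintegral_natCast_poissonMeasure : ∫⁻ k : ℕ, (k : ℝ≥0∞) ∂poissonMeasure r = r := by
  have weight_succ (n : ℕ) : ((n + 1 : ℕ) : ℝ≥0∞) * poissonMeasure r {n + 1} =
      r * poissonMeasure r {n} := by
    rw [poissonMeasure_singleton, poissonMeasure_singleton, ← ENNReal.ofReal_natCast,
      ← ENNReal.ofReal_coe_nnreal, ← ENNReal.ofReal_mul (by positivity),
      ← ENNReal.ofReal_mul (by positivity), Nat.factorial_succ]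
    congr 1
    push_cast
    field_simp
    ring
  have total : ∑' n, poissonMeasure r {n} = 1 := by
    simpa using (Measure.tsum_indicator_apply_singleton (poissonMeasure r) univ .univ)
  rw [lintegral_countable', tsum_eq_zero_add' ENNReal.summable]
  simp_rw [weight_succ]
  rw [ENNReal.tsum_mul_left, total]
  simp

theorem poissonMeasure_two_le : poissonMeasure r {k | 2 ≤ k} ≤ (r : ℝ≥0∞) ^ 2 := by
  have compl_eq : {k : ℕ | 2 ≤ k} = (({0, 1} : Finset ℕ) : Set ℕ)ᶜ := by
    ext k
    simp only [mem_ofPred_eq, mem_compl_iff, Finset.mem_coe, Finset.mem_insert,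
      Finset.mem_singleton]
    omega
  have real_le : (poissonMeasure r).real {k | 2 ≤ k} ≤ (r : ℝ) ^ 2 := by
    rw [compl_eq, probReal_compl_eq_one_sub (Finset.measurableSet _),
      ← sum_measureReal_singleton, Finset.sum_pair zero_ne_one, poissonMeasure_real_singleton,
      poissonMeasure_real_singleton]
    have exp_ge : 1 - (r : ℝ) ≤ Real.exp (-r) := by linarith [Real.add_one_le_exp (-(r : ℝ))]
    simp only [pow_zero, pow_one, Nat.factorial_zero, Nat.factorial_one, Nat.cast_one, mul_one,
      div_one]
    nlinarith [r.coe_nonneg]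
  rw [← ofReal_measureReal]
  refine (ENNReal.ofReal_le_ofReal real_le).trans_eq ?_
  rw [ENNReal.ofReal_pow r.coe_nonneg, ENNReal.ofReal_coe_nnreal]

end PoissonLaw

section Diagonals

theorem exists_mem_Ico_subdivision {a x : ℝ} (hx : x ∈ Ico a (a + 1)) (n : ℕ) :
    ∃ k < n + 1, x ∈ Ico (a + k / (n + 1)) (a + (k + 1) / (n + 1)) := by
  have hn : (0 : ℝ) < n + 1 := by positivity
  have scaled_nonneg : 0 ≤ (x - a) * (n + 1) := mul_nonneg (sub_nonneg.2 hx.1) hn.le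
  refine ⟨⌊(x - a) * (n + 1)⌋₊, ?_, ?_, ?_⟩
  · rw [Nat.floor_lt scaled_nonneg]
    push_cast
    nlinarith [hx.2]
  · rw [← le_sub_iff_add_le', div_le_iff₀ hn]
    exact Nat.floor_le scaled_nonneg
  · rw [← sub_lt_iff_lt_add', lt_div_iff₀ hn]
    exact Nat.lt_floor_add_one _

theorem measure_diagonal_eq_zero {m : Measure (ℝ × ℝ)} {K : ℝ≥0∞} (hK : K ≠ ∞)
    (hm : ∀ a b, m (Ico a b ×ˢ Ico a b) ≤ K * volume (Ico a b) ^ 2) : m (diagonal ℝ) = 0 := by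
  have unit_le (a : ℝ) (n : ℕ) :
      m {p | p.1 = p.2 ∧ p.1 ∈ Ico a (a + 1)} ≤ K * ((n + 1 : ℕ) : ℝ≥0∞)⁻¹ := by
    let cell (k : ℕ) : Set ℝ := Ico (a + k / (n + 1)) (a + (k + 1) / (n + 1))
    have volume_cell (k : ℕ) : volume (cell k) = ((n + 1 : ℕ) : ℝ≥0∞)⁻¹ := by
      rw [Real.volume_Ico, ← ENNReal.ofReal_natCast, ← ENNReal.ofReal_inv_of_pos (by positivity)]
      congr 1
      push_cast
      ring
    have cover : {p : ℝ × ℝ | p.1 = p.2 ∧ p.1 ∈ Ico a (a + 1)} ⊆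
        ⋃ k ∈ Finset.range (n + 1), cell k ×ˢ cell k := by
      rintro ⟨x, y⟩ ⟨hxy, hx⟩
      obtain rfl : x = y := hxy
      obtain ⟨k, hk, hxk⟩ := exists_mem_Ico_subdivision hx n
      exact mem_biUnion (Finset.mem_range.2 hk) ⟨hxk, hxk⟩
    calc m {p | p.1 = p.2 ∧ p.1 ∈ Ico a (a + 1)}
        ≤ ∑ k ∈ Finset.range (n + 1), m (cell k ×ˢ cell k) :=
          (measure_mono cover).trans (measure_biUnion_finset_le _ _)
      _ ≤ ∑ k ∈ Finset.range (n + 1), K * volume (cell k) ^ 2 :=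
          Finset.sum_le_sum fun k _ => hm _ _
      _ = K * ((n + 1 : ℕ) : ℝ≥0∞)⁻¹ := by
          simp_rw [volume_cell]
          rw [Finset.sum_const, Finset.card_range, nsmul_eq_mul, mul_left_comm, pow_two,
            ENNReal.mul_inv_cancel_left (by simp) (by simp)]
  have unit_null (a : ℝ) : m {p | p.1 = p.2 ∧ p.1 ∈ Ico a (a + 1)} = 0 := by
    have bound_tendsto := ENNReal.Tendsto.const_mul (a := K)
      (ENNReal.tendsto_inv_nat_nhds_zero.comp (tendsto_add_atTop_nat 1)) (Or.inr hK)
    rw [mul_zero] at bound_tendsto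
    exact le_antisymm (ge_of_tendsto' bound_tendsto (unit_le a)) zero_le
  refine measure_mono_null (fun p hp => ?_) (measure_iUnion_null fun z : ℤ => unit_null z)
  exact mem_iUnion.2 ⟨⌊p.1⌋, hp, Int.floor_le _, Int.lt_floor_add_one _⟩

theorem volume_eval_eq_eval {ι : Type*} [Fintype ι] {i j : ι} (hij : i ≠ j) :
    volume {x : ι → ℝ | x i = x j} = 0 := by
  classical
  let difference : (ι → ℝ) →ₗ[ℝ] ℝ :=
    (LinearMap.proj i : (ι → ℝ) →ₗ[ℝ] ℝ) - (LinearMap.proj j : (ι → ℝ) →ₗ[ℝ] ℝ)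
  have eq_ker : {x : ι → ℝ | x i = x j} = (LinearMap.ker difference : Set (ι → ℝ)) := by
    ext x
    simp [difference, sub_eq_zero]
  rw [eq_ker]
  refine Measure.addHaar_submodule _ _ fun ker_eq_top => ?_
  have : Pi.single i (1 : ℝ) ∈ LinearMap.ker difference := ker_eq_top ▸ Submodule.mem_top
  simp [difference, Pi.single_eq_of_ne hij.symm] at this

theorem measure_not_injective_eq_zero {n : ℕ} {m : Measure (Fin n → ℝ)}
    (hm : ∀ i j, i ≠ j → m {x | x i = x j} = 0) : m {x | ¬ Function.Injective x} = 0 := by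
  refine measure_mono_null (fun x hx => ?_)
    (measure_iUnion_null fun p : {p : Fin n × Fin n // p.1 ≠ p.2} => hm p.1.1 p.1.2 p.2)
  simp only [mem_ofPred_eq, Function.Injective, not_forall] at hx
  obtain ⟨i, j, hij, hne⟩ := hx
  exact mem_iUnion.2 ⟨⟨(i, j), hne⟩, hij⟩

end Diagonals

section DisjointBoxes

/-- The endpoints of `n` pairwise disjoint open intervals with rational endpoints. -/
abbrev DisjointRationalIntervals (n : ℕ) : Type :=
  {q : Fin n → ℚ × ℚ //
    Pairwise fun i j => Disjoint (Ioo ((q i).1 : ℝ) (q i).2) (Ioo ((q j).1 : ℝ) (q j).2)}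

variable {n : ℕ}

/-- The product of a family of rational intervals. -/
def rationalBox (q : DisjointRationalIntervals n) : Set (Fin n → ℝ) :=
  univ.pi fun k => Ioo ((q.1 k).1 : ℝ) (q.1 k).2

theorem exists_separation {x : Fin n → ℝ} (hx : Function.Injective x) :
    ∃ ε > 0, ∀ i j, i ≠ j → ε ≤ |x i - x j| := by
  obtain hne | hempty :=
    (Finset.univ.filter fun p : Fin n × Fin n => p.1 ≠ p.2).eq_empty_or_nonempty.symm
  · obtain ⟨p, hp, hmin⟩ := Finset.exists_min_image _
      (fun p : Fin n × Fin n => |x p.1 - x p.2|) hne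
    refine ⟨|x p.1 - x p.2|, abs_pos.2 (sub_ne_zero.2 fun heq => ?_), fun i j hij => ?_⟩
    · exact (Finset.mem_filter.1 hp).2 (hx heq)
    · exact hmin (i, j) (by simpa using hij)
  · refine ⟨1, one_pos, fun i j hij => absurd hempty (Finset.Nonempty.ne_empty ⟨(i, j), ?_⟩)⟩
    simpa using hij

theorem exists_mem_rationalBox {x : Fin n → ℝ} (hx : Function.Injective x) :
    ∃ q, x ∈ rationalBox q := by
  obtain ⟨ε, hε, hsep⟩ := exists_separation hx
  choose lower lower_gt lower_lt using fun k => exists_rat_btwn (sub_lt_self (x k) (half_pos hε))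
  choose upper upper_gt upper_lt using fun k => exists_rat_btwn (lt_add_of_pos_right (x k)
    (half_pos hε))
  refine ⟨⟨fun k => (lower k, upper k), fun i j hij => disjoint_left.2 ?_⟩,
    fun k _ => ⟨lower_lt k, upper_gt k⟩⟩
  rintro y ⟨hyi, hyi'⟩ ⟨hyj, hyj'⟩
  rcases abs_cases (x i - x j) with ⟨habs, _⟩ | ⟨habs, _⟩ <;>
    linarith [hsep i j hij, lower_gt i, lower_gt j, upper_lt i, upper_lt j]

theorem ext_of_restrict_rationalBox {m m' : Measure (Fin n → ℝ)}
    (hm : ∀ i j, i ≠ j → m {x | x i = x j} = 0) (hm' : ∀ i j, i ≠ j → m' {x | x i = x j} = 0)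
    (h : ∀ q, m.restrict (rationalBox q) = m'.restrict (rationalBox q)) : m = m' := by
  have subset_boxes : {x : Fin n → ℝ | Function.Injective x} ⊆ ⋃ q, rationalBox q :=
    fun x hx => mem_iUnion.2 (exists_mem_rationalBox hx)
  have ae_mem_boxes {μ : Measure (Fin n → ℝ)} (hμ : ∀ i j, i ≠ j → μ {x | x i = x j} = 0) :
      ∀ᵐ x ∂μ, x ∈ ⋃ q, rationalBox q :=
    mem_ae_iff.2 (measure_mono_null (compl_subset_compl.2 subset_boxes)
      (measure_not_injective_eq_zero hμ))
  have restrict_eq := Measure.restrict_iUnion_congr.2 h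
  rwa [Measure.restrict_eq_self_of_ae_mem (ae_mem_boxes hm),
    Measure.restrict_eq_self_of_ae_mem (ae_mem_boxes hm')] at restrict_eq

end DisjointBoxes

section PoissonProcess

/-- The counting measure `∑ⱼ δ_{uⱼ}` of a sequence of points, with multiplicities. -/
def countingMeasure (u : ℕ → ℝ) : Measure ℝ := Measure.sum fun j => Measure.dirac (u j)

theorem countingMeasure_apply (u : ℕ → ℝ) {A : Set ℝ} (hA : MeasurableSet A) :
    countingMeasure u A = ∑' j, A.indicator 1 (u j) := by
  simp [countingMeasure, Measure.sum_apply _ hA, Measure.dirac_apply' _ hA]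

theorem two_le_countingMeasure {u : ℕ → ℝ} {i j : ℕ} (hij : i ≠ j) {A : Set ℝ}
    (hA : MeasurableSet A) (hi : u i ∈ A) (hj : u j ∈ A) : 2 ≤ countingMeasure u A := by
  rw [countingMeasure_apply u hA]
  refine le_trans ?_ (ENNReal.sum_le_tsum {i, j})
  rw [Finset.sum_pair hij, indicator_of_mem hi, indicator_of_mem hj]
  exact one_add_one_eq_two.ge

variable {Ω : Type*} [MeasurableSpace Ω] {P : Measure Ω} {ν : ℝ≥0} {U : ℕ → Ω → ℝ}

theorem measurable_countingMeasure_apply (hU : ∀ j, Measurable (U j)) {A : Set ℝ}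
    (hA : MeasurableSet A) : Measurable fun ω => countingMeasure (U · ω) A := by
  simp_rw [countingMeasure_apply _ hA]
  exact Measurable.tsum fun j => (measurable_one.indicator hA).comp (hU j)

namespace IsPoissonProcess

theorem map_countingMeasure_apply (h : IsPoissonProcess P ν U) {A : Set ℝ}
    (hA : MeasurableSet A) (hfin : volume A ≠ ∞) :
    P.map (fun ω => countingMeasure (U · ω) A) =
      (poissonMeasure (ν * (volume A).toNNReal)).map (fun k : ℕ => (k : ℝ≥0∞)) :=
  h.law A hA hfin

theorem lintegral_countingMeasure_apply (h : IsPoissonProcess P ν U) {A : Set ℝ}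
    (hA : MeasurableSet A) (hfin : volume A ≠ ∞) :
    ∫⁻ ω, countingMeasure (U · ω) A ∂P = ν * volume A := by
  rw [← lintegral_map (f := fun x => x) measurable_id'
      (measurable_countingMeasure_apply h.measurable hA), h.map_countingMeasure_apply hA hfin,
    lintegral_map measurable_id' (by fun_prop), lintegral_natCast_poissonMeasure,
    ENNReal.coe_mul, ENNReal.coe_toNNReal hfin]

theorem measure_two_le_countingMeasure_le (h : IsPoissonProcess P ν U) {A : Set ℝ}
    (hA : MeasurableSet A) (hfin : volume A ≠ ∞) :
    P {ω | 2 ≤ countingMeasure (U · ω) A} ≤ (ν * volume A) ^ 2 := by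
  have preimage_cast : (fun k : ℕ => (k : ℝ≥0∞)) ⁻¹' Ici 2 = {k | 2 ≤ k} := by
    ext k
    simp
  calc P {ω | 2 ≤ countingMeasure (U · ω) A}
      = P.map (fun ω => countingMeasure (U · ω) A) (Ici 2) :=
        (Measure.map_apply (measurable_countingMeasure_apply h.measurable hA)
          measurableSet_Ici).symm
    _ = poissonMeasure (ν * (volume A).toNNReal) {k | 2 ≤ k} := by
        rw [h.map_countingMeasure_apply hA hfin, Measure.map_apply (by fun_prop) measurableSet_Ici,
          preimage_cast]
    _ ≤ (ν * volume A) ^ 2 := by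
        refine (poissonMeasure_two_le _).trans_eq ?_
        rw [ENNReal.coe_mul, ENNReal.coe_toNNReal hfin]

theorem measure_eq_eq_zero (h : IsPoissonProcess P ν U) {i j : ℕ} (hij : i ≠ j) :
    P {ω | U i ω = U j ω} = 0 := by
  have hpair : Measurable fun ω => (U i ω, U j ω) := (h.measurable i).prodMk (h.measurable j)
  have square_le (a b : ℝ) : P.map (fun ω => (U i ω, U j ω)) (Ico a b ×ˢ Ico a b) ≤
      (ν : ℝ≥0∞) ^ 2 * volume (Ico a b) ^ 2 := by
    rw [Measure.map_apply hpair (measurableSet_Ico.prod measurableSet_Ico), ← mul_pow]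
    exact (measure_mono fun ω hω => two_le_countingMeasure (u := (U · ω)) hij measurableSet_Ico
      hω.1 hω.2).trans (h.measure_two_le_countingMeasure_le measurableSet_Ico (by simp))
  have := measure_diagonal_eq_zero (by simp) square_le
  rwa [Measure.map_apply hpair measurableSet_diagonal] at this

theorem tsum_measure_pi (h : IsPoissonProcess P ν U) {n : ℕ} {A : Fin n → Set ℝ}
    (hA : ∀ k, MeasurableSet (A k)) (hfin : ∀ k, volume (A k) ≠ ∞)
    (hd : Pairwise fun i j => Disjoint (A i) (A j)) :
    ∑' e : Fin n → ℕ, P {ω | ∀ k, U (e k) ω ∈ A k} = ∏ k, ν * volume (A k) := by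
  have measurable_box (e : Fin n → ℕ) : MeasurableSet {ω | ∀ k, U (e k) ω ∈ A k} := by
    rw [ofPred_forall]
    exact MeasurableSet.iInter fun k => h.measurable _ (hA k)
  have prod_indicator (e : Fin n → ℕ) (ω : Ω) :
      ∏ k, (A k).indicator (1 : ℝ → ℝ≥0∞) (U (e k) ω) =
        indicator {ω | ∀ k, U (e k) ω ∈ A k} 1 ω := by
    classical
    simp only [indicator_apply, Pi.one_apply, Finset.prod_ite_zero, Finset.prod_const_one,
      Finset.mem_univ, true_imp_iff, mem_ofPred_eq]
  calc ∑' e : Fin n → ℕ, P {ω | ∀ k, U (e k) ω ∈ A k}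
      = ∫⁻ ω, ∏ k, countingMeasure (U · ω) (A k) ∂P := by
        simp_rw [countingMeasure_apply _ (hA _), prod_tsum_eq_tsum_prod, prod_indicator]
        rw [lintegral_tsum fun e => (measurable_one.indicator (measurable_box e)).aemeasurable]
        simp_rw [lintegral_indicator_one (measurable_box _)]
    _ = ∏ k, ν * volume (A k) := by
        simp_rw [← h.lintegral_countingMeasure_apply (hA _) (hfin _)]
        exact lintegral_prod_eq_prod_lintegral_of_indepFun _ _ (h.indep n A hA hd)
          fun k => measurable_countingMeasure_apply h.measurable (hA k)

theorem tsum_embedding_measure_pi (h : IsPoissonProcess P ν U) {n : ℕ} {A : Fin n → Set ℝ}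
    (hA : ∀ k, MeasurableSet (A k)) (hfin : ∀ k, volume (A k) ≠ ∞)
    (hd : Pairwise fun i j => Disjoint (A i) (A j)) :
    ∑' e : Fin n ↪ ℕ, P {ω | ∀ k, U (e k) ω ∈ A k} = ∏ k, ν * volume (A k) := by
  rw [← h.tsum_measure_pi hA hfin hd]
  refine Function.Injective.tsum_eq (f := fun e : Fin n → ℕ => P {ω | ∀ k, U (e k) ω ∈ A k})
    (g := fun e : Fin n ↪ ℕ => (e : Fin n → ℕ)) DFunLike.coe_injective fun e he => ?_
  obtain ⟨ω, hω⟩ := nonempty_of_measure_ne_zero he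
  have e_injective : Function.Injective e := fun a b hab => by
    by_contra hne
    exact disjoint_left.1 (hd hne) (hω a) (hab ▸ hω b)
  exact ⟨⟨e, e_injective⟩, rfl⟩

theorem sum_map_embedding [IsProbabilityMeasure P] (h : IsPoissonProcess P ν U) (n : ℕ) :
    Measure.sum (fun e : Fin n ↪ ℕ => P.map fun ω k => U (e k) ω) =
      Measure.pi fun _ : Fin n => ν • (volume : Measure ℝ) := by
  have measurable_tuple (e : Fin n ↪ ℕ) : Measurable fun ω k => U (e k) ω :=
    measurable_pi_lambda _ fun k => h.measurable _
  have measurable_eval_eq (i j : Fin n) : MeasurableSet {x : Fin n → ℝ | x i = x j} :=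
    measurableSet_eq_fun (measurable_pi_apply _) (measurable_pi_apply _)
  refine ext_of_restrict_rationalBox (fun i j hij => ?_) (fun i j hij => ?_) fun q => ?_
  · rw [Measure.sum_apply _ (measurable_eval_eq i j), ENNReal.tsum_eq_zero]
    intro e
    rw [Measure.map_apply (measurable_tuple e) (measurable_eval_eq i j)]
    exact h.measure_eq_eq_zero fun heq => hij (e.injective heq)
  · have pi_eq_smul : Measure.pi (fun _ : Fin n => ν • (volume : Measure ℝ)) =
        (∏ _k : Fin n, (ν : ℝ≥0∞)) • volume := Measure.pi_eq fun s _ => by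
      simp only [Measure.smul_apply, volume_pi_pi, Finset.prod_mul_distrib, ENNReal.smul_def,
        smul_eq_mul]
    rw [pi_eq_smul, Measure.smul_apply, volume_eval_eq_eval hij, smul_zero]
  · have measurable_slice {s : Fin n → Set ℝ} (hs : ∀ k, MeasurableSet (s k)) (k : Fin n) :
        MeasurableSet (s k ∩ Ioo ((q.1 k).1 : ℝ) (q.1 k).2) := (hs k).inter measurableSet_Ioo
    rw [rationalBox, Measure.restrict_pi_pi]
    refine (Measure.pi_eq fun s hs => ?_).symm
    have count_box := h.tsum_embedding_measure_pi (measurable_slice hs)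
      (fun k => ((measure_mono inter_subset_right).trans_lt (by simp)).ne)
      (fun i j hij => (q.2 hij).mono inter_subset_right inter_subset_right)
    rw [Measure.restrict_apply (MeasurableSet.univ_pi hs), ← pi_inter_distrib,
      Measure.sum_apply _ (MeasurableSet.univ_pi (measurable_slice hs))]
    simp_rw [Measure.restrict_apply (hs _), Measure.smul_apply, ENNReal.smul_def, smul_eq_mul]
    rw [← count_box]
    congr 1 with e
    rw [Measure.map_apply (measurable_tuple e) (MeasurableSet.univ_pi (measurable_slice hs))]
    simp [Set.preimage, Set.mem_pi]

end IsPoissonProcess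

end PoissonProcess

/-! ### The marked process of immigrants, clusters and signs -/

section MarkedProcess

/-- The law of a `±1`-valued sign with mean `θ`, for `θ ∈ [-1, 1]`. -/
def signLaw (θ : ℝ) : Measure ℝ :=
  ENNReal.ofReal ((1 + θ) / 2) • Measure.dirac 1 + ENNReal.ofReal ((1 - θ) / 2) • Measure.dirac (-1)

instance (θ : ℝ) : IsFiniteMeasure (signLaw θ) := by
  constructor
  simp [signLaw]

/-- The intensity of the marked Poisson process of triples (immigrant, cluster, sign). -/
def markLaw (ν : ℝ≥0) (Q : Measure (Measure ℝ)) (θ : ℝ) : Measure (ℝ × Measure ℝ × ℝ) :=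
  (ν • (volume : Measure ℝ)).prod (Q.prod (signLaw θ))

theorem measurePreserving_zip {ι α β γ : Type*} [Fintype ι] [MeasurableSpace α]
    [MeasurableSpace β] [MeasurableSpace γ] (μ : Measure α) (ν : Measure β) (τ : Measure γ)
    [SigmaFinite μ] [SigmaFinite ν] [SigmaFinite τ] :
    MeasurePreserving (fun (p : (ι → α) × (ι → β) × (ι → γ)) k => (p.1 k, p.2.1 k, p.2.2 k))
      ((Measure.pi fun _ => μ).prod ((Measure.pi fun _ => ν).prod (Measure.pi fun _ => τ)))
      (Measure.pi fun _ => μ.prod (ν.prod τ)) :=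
  (measurePreserving_arrowProdEquivProdArrow α (β × γ) ι (fun _ => μ)
      (fun _ => ν.prod τ)).symm.comp
    ((MeasurePreserving.id _).prod
      (measurePreserving_arrowProdEquivProdArrow β γ ι (fun _ => ν) (fun _ => τ)).symm)

theorem eq_signLaw_of_singletons {m : Measure ℝ} [IsProbabilityMeasure m] {θ : ℝ}
    (hθ : θ ∈ Icc (-1 : ℝ) 1) (hpos : m {1} = ENNReal.ofReal ((1 + θ) / 2))
    (hneg : m {-1} = ENNReal.ofReal ((1 - θ) / 2)) : m = signLaw θ := by
  have hdisj : Disjoint ({1} : Set ℝ) {-1} := by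
    rw [disjoint_singleton]
    norm_num
  have hsupp : m ({1} ∪ {-1})ᶜ = 0 := by
    rw [prob_compl_eq_zero_iff ((measurableSet_singleton _).union (measurableSet_singleton _)),
      measure_union hdisj (measurableSet_singleton _), hpos, hneg,
      ← ENNReal.ofReal_add (by linarith [hθ.1]) (by linarith [hθ.2]), ← add_div]
    norm_num
  rw [← Measure.restrict_eq_self_of_ae_mem (s := {1} ∪ {-1}) (mem_ae_iff.2 hsupp),
    Measure.restrict_union hdisj (measurableSet_singleton _), Measure.restrict_singleton,
    Measure.restrict_singleton, hpos, hneg, signLaw]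

variable {Ω : Type*} [MeasurableSpace Ω] {P : Measure Ω} {ν : ℝ≥0}
  {Q : Measure (Measure ℝ)} {U : ℕ → Ω → ℝ} {C : ℕ → Ω → Measure ℝ} {S : ℝ → ℕ → Ω → ℝ} {θ : ℝ}

/-- A Poisson process of immigrants `U` carrying independent clusters `C` of law `Q` and independent
signs `S` of mean `θ`. Compared with `IsSignSymmetrizedFamily`, the parameter `θ` is fixed and the
clusters have neither a root nor a direction. -/
structure IsSignedClusterFamily (P : Measure Ω) (ν : ℝ≥0) (Q : Measure (Measure ℝ)) (θ : ℝ)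
    (U : ℕ → Ω → ℝ) (C : ℕ → Ω → Measure ℝ) (S : ℕ → Ω → ℝ) : Prop where
  poisson : IsPoissonProcess P ν U
  finiteSimple : ∀ᵐ μ ∂Q, IsFiniteSimpleCounting μ
  thirdMoment : ∫⁻ μ, (μ univ) ^ 3 ∂Q < ∞
  measurable_cluster : ∀ j, Measurable (C j)
  law_cluster : ∀ j, P.map (C j) = Q
  indep_clusters : iIndepFun C P
  indep_immigrants_clusters : IndepFun (fun ω j => U j ω) (fun ω j => C j ω) P
  measurable_sign : ∀ j, Measurable (S j)
  law_sign : ∀ j, P.map (S j) = signLaw θ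
  indep_signs : iIndepFun S P
  indep_signs_rest :
    IndepFun (fun ω j => S j ω) (fun ω => ((fun j => U j ω), (fun j => C j ω))) P

theorem IsSignSymmetrizedFamily.isSignedClusterFamily [IsProbabilityMeasure P]
    (h : IsSignSymmetrizedFamily P ν Q U C S) (hθ : θ ∈ Icc (-1 : ℝ) 1) :
    IsSignedClusterFamily P ν Q θ U C (S θ) where
  poisson := h.poisson
  finiteSimple := h.clusterLaw.finiteSimple
  thirdMoment := h.clusterLaw.thirdMoment
  measurable_cluster := h.measurable_cluster
  law_cluster := h.law_cluster
  indep_clusters := h.indep_clusters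
  indep_immigrants_clusters := h.indep_immigrants_clusters
  measurable_sign := h.measurable_sign θ hθ
  law_sign j := by
    have hS := h.measurable_sign θ hθ j
    have : IsProbabilityMeasure (P.map (S θ j)) :=
      Measure.isProbabilityMeasure_map hS.aemeasurable
    apply eq_signLaw_of_singletons hθ
    · rw [Measure.map_apply hS (measurableSet_singleton _)]
      exact h.sign_pos θ hθ j
    · rw [Measure.map_apply hS (measurableSet_singleton _)]
      exact h.sign_neg θ hθ j
  indep_signs := h.indep_signs θ hθ
  indep_signs_rest := h.indep_signs_rest θ hθ

namespace IsSignedClusterFamily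

variable {S : ℕ → Ω → ℝ}

theorem measurable_mark (h : IsSignedClusterFamily P ν Q θ U C S)
    (j : ℕ) : Measurable fun ω => (U j ω, C j ω, S j ω) :=
  (h.poisson.measurable j).prodMk ((h.measurable_cluster j).prodMk (h.measurable_sign j))

variable [IsProbabilityMeasure P]

theorem isProbabilityMeasure_clusterLaw (h : IsSignedClusterFamily P ν Q θ U C S) :
    IsProbabilityMeasure Q := by
  rw [← h.law_cluster 0]
  exact Measure.isProbabilityMeasure_map (h.measurable_cluster 0).aemeasurable

variable {n : ℕ} (e : Fin n ↪ ℕ)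

theorem map_clusters (h : IsSignedClusterFamily P ν Q θ U C S) :
    P.map (fun ω k => C (e k) ω) = Measure.pi fun _ => Q := by
  rw [(iIndepFun_iff_map_fun_eq_pi_map fun k => (h.measurable_cluster _).aemeasurable).1
    (h.indep_clusters.precomp e.injective)]
  simp_rw [h.law_cluster]

theorem map_signs (h : IsSignedClusterFamily P ν Q θ U C S) :
    P.map (fun ω k => S (e k) ω) = Measure.pi fun _ => signLaw θ := by
  rw [(iIndepFun_iff_map_fun_eq_pi_map fun k => (h.measurable_sign _).aemeasurable).1
    (h.indep_signs.precomp e.injective)]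
  simp_rw [h.law_sign]

theorem map_immigrants_clusters_signs (h : IsSignedClusterFamily P ν Q θ U C S) :
    P.map (fun ω => ((fun k => U (e k) ω), (fun k => C (e k) ω), fun k => S (e k) ω)) =
      (P.map fun ω k => U (e k) ω).prod
        ((Measure.pi fun _ => Q).prod (Measure.pi fun _ => signLaw θ)) := by
  have := h.isProbabilityMeasure_clusterLaw
  have hU : Measurable fun ω k => U (e k) ω :=
    measurable_pi_lambda _ fun k => h.poisson.measurable _
  have hC : Measurable fun ω k => C (e k) ω :=
    measurable_pi_lambda _ fun k => h.measurable_cluster _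
  have hS : Measurable fun ω k => S (e k) ω :=
    measurable_pi_lambda _ fun k => h.measurable_sign _
  have measurable_select {α : Type _} [MeasurableSpace α] :
      Measurable fun (x : ℕ → α) (k : Fin n) => x (e k) :=
    measurable_pi_lambda _ fun k => measurable_pi_apply _
  have indep_UC : IndepFun (fun ω k => U (e k) ω) (fun ω k => C (e k) ω) P :=
    h.indep_immigrants_clusters.comp measurable_select measurable_select
  have indep_UC_S : IndepFun (fun ω => ((fun k => U (e k) ω), fun k => C (e k) ω))
      (fun ω k => S (e k) ω) P :=
    h.indep_signs_rest.symm.comp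
      (φ := fun p : (ℕ → ℝ) × (ℕ → Measure ℝ) => ((fun k : Fin n => p.1 (e k)),
        fun k : Fin n => p.2 (e k)))
      ((measurable_select.comp measurable_fst).prodMk (measurable_select.comp measurable_snd))
      measurable_select
  have joint_law := (indepFun_iff_map_prod_eq_prod_map_map (hU.prodMk hC).aemeasurable
    hS.aemeasurable).1 indep_UC_S
  rw [(indepFun_iff_map_prod_eq_prod_map_map hU.aemeasurable hC.aemeasurable).1 indep_UC,
    h.map_clusters, h.map_signs e] at joint_law
  rw [← Measure.prodAssoc_prod, ← joint_law,
    Measure.map_map MeasurableEquiv.prodAssoc.measurable ((hU.prodMk hC).prodMk hS)]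
  rfl

theorem sum_map_embedding (h : IsSignedClusterFamily P ν Q θ U C S) (n : ℕ) :
    Measure.sum (fun e : Fin n ↪ ℕ => P.map fun ω k => (U (e k) ω, C (e k) ω, S (e k) ω)) =
      Measure.pi fun _ => markLaw ν Q θ := by
  have := h.isProbabilityMeasure_clusterLaw
  have zip := measurePreserving_zip (ι := Fin n) (ν • (volume : Measure ℝ)) Q (signLaw θ)
  have map_marks (e : Fin n ↪ ℕ) : P.map (fun ω k => (U (e k) ω, C (e k) ω, S (e k) ω)) =
      ((P.map fun ω k => U (e k) ω).prod
        ((Measure.pi fun _ => Q).prod (Measure.pi fun _ => signLaw θ))).map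
          fun p k => (p.1 k, p.2.1 k, p.2.2 k) := by
    rw [← h.map_immigrants_clusters_signs e, Measure.map_map zip.measurable]
    · rfl
    · exact (measurable_pi_lambda _ fun k => h.poisson.measurable _).prodMk
        ((measurable_pi_lambda _ fun k => h.measurable_cluster _).prodMk
          (measurable_pi_lambda _ fun k => h.measurable_sign _))
  simp_rw [map_marks]
  rw [← Measure.map_sum zip.measurable.aemeasurable, ← Measure.prod_sum_left,
    h.poisson.sum_map_embedding n, zip.map_eq]
  rfl

end IsSignedClusterFamily

end MarkedProcess

/-! ### Sums over tuples of distinct indices -/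

section DistinctTuples

variable {α : Type*}

theorem tsum_embedding {M ι : Type*} [AddCommMonoid M] [TopologicalSpace M] (F : (ι → α) → M) :
    ∑' e : ι ↪ α, F e = ∑' y, indicator {y | Function.Injective y} F y := by
  rw [← tsum_subtype, ← (Equiv.subtypeInjectiveEquivEmbedding ι α).tsum_eq]
  rfl

theorem tsum_fin_succ {n : ℕ} (F : (Fin (n + 1) → α) → ℝ≥0∞) :
    ∑' y, F y = ∑' a, ∑' y, F (Fin.cons a y) := by
  rw [← (Fin.consEquiv fun _ : Fin (n + 1) => α).tsum_eq, ENNReal.tsum_prod']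
  rfl

theorem tsum_fin_one (F : (Fin 1 → α) → ℝ≥0∞) : ∑' y, F y = ∑' a, F ![a] := by
  rw [tsum_fin_succ]
  exact tsum_congr fun a => tsum_eq_single ![] fun b hb => absurd (Subsingleton.elim _ _) hb

theorem tsum_embedding_one (F : (Fin 1 → α) → ℝ≥0∞) :
    ∑' e : Fin 1 ↪ α, F e = ∑' a, F ![a] := by
  rw [tsum_embedding, tsum_fin_one]
  exact tsum_congr fun a => indicator_of_mem (Function.injective_of_subsingleton ![a]) F

theorem injective_vec_two {a b : α} : Function.Injective ![a, b] ↔ a ≠ b := by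
  simp [Function.Injective, Fin.forall_fin_two, eq_comm]

theorem injective_vec_three {a b c : α} :
    Function.Injective ![a, b, c] ↔ a ≠ b ∧ a ≠ c ∧ b ≠ c := by
  simp [Function.Injective, Fin.forall_fin_succ, eq_comm]
  tauto

open Classical in
theorem tsum_embedding_two (F : (Fin 2 → α) → ℝ≥0∞) :
    ∑' e : Fin 2 ↪ α, F e = ∑' a, ∑' b, if a ≠ b then F ![a, b] else 0 := by
  rw [tsum_embedding, tsum_fin_succ]
  simp_rw [tsum_fin_one, ← injective_vec_two]
  simp only [indicator_apply]
  rfl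

open Classical in
theorem tsum_embedding_three (F : (Fin 3 → α) → ℝ≥0∞) :
    ∑' e : Fin 3 ↪ α, F e =
      ∑' a, ∑' b, ∑' c, if a ≠ b ∧ a ≠ c ∧ b ≠ c then F ![a, b, c] else 0 := by
  rw [tsum_embedding, tsum_fin_succ]
  congr 1 with a
  rw [tsum_fin_succ]
  simp_rw [tsum_fin_one, ← injective_vec_three]
  simp only [indicator_apply]
  rfl

theorem tsum_eq_add_tsum_embedding_two (f : α → α → ℝ≥0∞) :
    ∑' a, ∑' b, f a b = ∑' a, f a a + ∑' e : Fin 2 ↪ α, f (e 0) (e 1) := by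
  classical
  rw [tsum_embedding_two fun e => f (e 0) (e 1), ← ENNReal.tsum_add]
  congr 1 with a
  rw [← tsum_ite_eq a (fun b => f a b), ← ENNReal.tsum_add]
  congr 1 with b
  by_cases h : a = b
  · simp [h]
  · simp [h, Ne.symm h]

theorem tsum_eq_add_tsum_embedding_three (f : α → α → α → ℝ≥0∞) :
    ∑' a, ∑' b, ∑' c, f a b c = ∑' a, f a a a
      + ∑' e : Fin 2 ↪ α, (f (e 0) (e 0) (e 1) + f (e 0) (e 1) (e 0) + f (e 1) (e 0) (e 0))
      + ∑' e : Fin 3 ↪ α, f (e 0) (e 1) (e 2) := by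
  classical
  have split_third (a b : α) (hab : a ≠ b) : ∑' c, f a b c =
      f a b a + f a b b + ∑' c, if a ≠ b ∧ a ≠ c ∧ b ≠ c then f a b c else 0 := by
    rw [← tsum_ite_eq a (fun c => f a b c), ← tsum_ite_eq b (fun c => f a b c),
      ← ENNReal.tsum_add, ← ENNReal.tsum_add]
    congr 1 with c
    split_ifs <;> grind
  have swap : ∑' e : Fin 2 ↪ α, f (e 0) (e 1) (e 1) = ∑' e : Fin 2 ↪ α, f (e 1) (e 0) (e 0) := by
    rw [tsum_embedding_two fun e => f (e 0) (e 1) (e 1),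
      tsum_embedding_two fun e => f (e 1) (e 0) (e 0), ENNReal.tsum_comm]
    simp [eq_comm]
  have split_distinct : ∑' e : Fin 2 ↪ α, ∑' c, f (e 0) (e 1) c =
      ∑' e : Fin 2 ↪ α, f (e 0) (e 1) (e 0) + ∑' e : Fin 2 ↪ α, f (e 0) (e 1) (e 1) +
        ∑' e : Fin 3 ↪ α, f (e 0) (e 1) (e 2) := by
    rw [tsum_embedding_three fun e => f (e 0) (e 1) (e 2), ← ENNReal.tsum_add,
      tsum_embedding_two fun e => ∑' c, f (e 0) (e 1) c,
      tsum_embedding_two fun e => f (e 0) (e 1) (e 0) + f (e 0) (e 1) (e 1), ← ENNReal.tsum_add]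
    congr 1 with a
    rw [← ENNReal.tsum_add]
    congr 1 with b
    by_cases hab : a = b
    · simp [hab]
    · simpa [hab] using split_third a b hab
  rw [tsum_eq_add_tsum_embedding_two fun a b => ∑' c, f a b c,
    tsum_eq_add_tsum_embedding_two fun a c => f a a c, split_distinct, swap, ENNReal.tsum_add,
    ENNReal.tsum_add]
  ring

end DistinctTuples

/-! ### Tuples of distinct points -/

section OffDiagonal

variable {E : Type*} [MeasurableSpace E]

/-- Pairs of distinct points. -/
def offDiag2 : Set (E × E) := {p | p.1 ≠ p.2}

/-- Triples of pairwise distinct points. -/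
def offDiag3 : Set (E × E × E) := {p | p.1 ≠ p.2.1 ∧ p.1 ≠ p.2.2 ∧ p.2.1 ≠ p.2.2}

variable [MeasurableEq E]

theorem measurableSet_offDiag2 : MeasurableSet (offDiag2 : Set (E × E)) :=
  (measurableSet_eq_fun measurable_fst measurable_snd).compl

theorem measurableSet_offDiag3 : MeasurableSet (offDiag3 : Set (E × E × E)) :=
  ((measurableSet_eq_fun (by fun_prop) (by fun_prop)).compl).inter
    (((measurableSet_eq_fun (by fun_prop) (by fun_prop)).compl).inter
      ((measurableSet_eq_fun (by fun_prop) (by fun_prop)).compl))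

theorem ae_prod_fst_ne_snd {A : Type*} [MeasurableSpace A] (m : Measure A) [SFinite m]
    {κ : Measure E} [SFinite κ] [NullSingletonClass κ] {f : A → E} (hf : Measurable f) :
    ∀ᵐ q ∂m.prod κ, f q.1 ≠ q.2 := by
  refine (Measure.ae_prod_iff_ae_ae ?_).2 (Eventually.of_forall fun a => ?_)
  · exact (measurableSet_eq_fun (by fun_prop) (by fun_prop)).compl
  · filter_upwards [compl_mem_ae_iff.2 (measure_singleton (μ := κ) (f a))] with w hw h
    exact hw h.symm

variable (m : Measure E) [SFinite m] [NullSingletonClass m]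

theorem prod_restrict_offDiag2 : (m.prod m).restrict offDiag2 = m.prod m :=
  Measure.restrict_eq_self_of_ae_mem (ae_prod_fst_ne_snd _ measurable_id)

theorem prod_prod_restrict_offDiag3 :
    (m.prod (m.prod m)).restrict offDiag3 = m.prod (m.prod m) := by
  have ne_pair (x : E) : ∀ᵐ q ∂m.prod m, x ≠ q.1 ∧ x ≠ q.2 := by
    have ne : ∀ᵐ y ∂m, x ≠ y := by
      filter_upwards [compl_mem_ae_iff.2 (measure_singleton (μ := m) x)] with y hy h
      exact hy h.symm
    exact (Measure.quasiMeasurePreserving_fst.ae ne).and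
      (Measure.quasiMeasurePreserving_snd.ae ne)
  refine Measure.restrict_eq_self_of_ae_mem
    ((Measure.ae_prod_iff_ae_ae measurableSet_offDiag3).2 (Eventually.of_forall fun x => ?_))
  filter_upwards [ne_pair x, ae_prod_fst_ne_snd m (κ := m) measurable_id] with q hx hq
  exact ⟨hx.1, hx.2, hq⟩

end OffDiagonal

/-! ### Products of measures and of kernels -/

section ProductMeasures

variable {A B C : Type*} [MeasurableSpace A] [MeasurableSpace B] [MeasurableSpace C]
  (m : Measure A) (m' : Measure B) (m'' : Measure C) [SFinite m] [SFinite m'] [SFinite m'']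

theorem prod_prod_eq_map_fst_fst : m.prod (m'.prod m'') =
    ((m.prod m').prod m'').map fun q => (q.1.1, q.1.2, q.2) :=
  Measure.prodAssoc_prod.symm

theorem prod_prod_eq_map_snd_fst : m''.prod (m.prod m') =
    ((m.prod m').prod m'').map fun q => (q.2, q.1.1, q.1.2) :=
  Measure.prod_swap.symm

theorem prod_prod_eq_map_fst_snd : m.prod (m''.prod m') =
    ((m.prod m').prod m'').map fun q => (q.1.1, q.2, q.1.2) := by
  have swap_last : m.prod (m''.prod m') = (m.prod (m'.prod m'')).map (Prod.map id Prod.swap) := by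
    rw [← Measure.map_prod_map _ _ measurable_id measurable_swap, Measure.map_id,
      Measure.prod_swap]
  rw [swap_last, prod_prod_eq_map_fst_fst, Measure.map_map (by fun_prop) (by fun_prop)]
  rfl

theorem bind_prod_bind {X Y : Type*} [MeasurableSpace X] [MeasurableSpace Y] (ρ : Measure X)
    (ρ' : Measure Y) [SFinite ρ] [SFinite ρ'] (κ : Kernel X A) (η : Kernel Y B)
    [IsSFiniteKernel κ] [IsSFiniteKernel η] :
    (ρ.bind κ).prod (ρ'.bind η) = (ρ.prod ρ').bind (κ ∥ₖ η) := by
  refine Measure.ext_of_lintegral _ fun F hF => ?_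
  have measurable_inner : Measurable fun p : A × Y => ∫⁻ b, F (p.1, b) ∂η p.2 :=
    Measurable.lintegral_kernel_prod_right' (κ := η.comap Prod.snd measurable_snd)
      (f := fun p : (A × Y) × B => F (p.1.1, p.2)) (by fun_prop)
  have inner_bind (a : A) : ∫⁻ b, F (a, b) ∂ρ'.bind η = ∫⁻ y, ∫⁻ b, F (a, b) ∂η y ∂ρ' :=
    Measure.lintegral_bind η.measurable.aemeasurable (by fun_prop)
  rw [lintegral_prod _ hF.aemeasurable, Measure.lintegral_bind κ.measurable.aemeasurable
      hF.lintegral_prod_right'.aemeasurable,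
    Measure.lintegral_bind (Kernel.measurable _).aemeasurable hF.aemeasurable,
    lintegral_prod _ hF.lintegral_kernel.aemeasurable]
  congr 1 with x
  simp_rw [inner_bind]
  rw [lintegral_lintegral_swap measurable_inner.aemeasurable]
  congr 1 with y
  rw [Kernel.parallelComp_apply, lintegral_prod _ hF.aemeasurable]

end ProductMeasures

section ProductKernels

variable {X Y E : Type*} [MeasurableSpace X] [MeasurableSpace Y] [MeasurableSpace E]
  {η : Kernel X E} [IsSFiniteKernel η]

theorem measurable_lintegral_prod {a b : Y → X} (ha : Measurable a) (hb : Measurable b)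
    {F : E × E → ℝ≥0∞} (hF : Measurable F) :
    Measurable fun y => ∫⁻ p, F p ∂(η (a y)).prod (η (b y)) := by
  have := hF.lintegral_kernel (κ := (η.comap a ha) ×ₖ (η.comap b hb))
  simpa only [Kernel.prod_apply, Kernel.comap_apply] using this

theorem measurable_lintegral_prod_prod {a b c : Y → X} (ha : Measurable a) (hb : Measurable b)
    (hc : Measurable c) {F : E × E × E → ℝ≥0∞} (hF : Measurable F) :
    Measurable fun y => ∫⁻ p, F p ∂(η (a y)).prod ((η (b y)).prod (η (c y))) := by
  have := hF.lintegral_kernel (κ := (η.comap a ha) ×ₖ ((η.comap b hb) ×ₖ (η.comap c hc)))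
  simpa only [Kernel.prod_apply, Kernel.comap_apply] using this

theorem lintegral_sum_prod_sum (m : ℕ → Measure E) [∀ i, SFinite (m i)] (F : E × E → ℝ≥0∞) :
    ∫⁻ p, F p ∂(Measure.sum m).prod (Measure.sum m)
      = ∑' i, ∑' j, ∫⁻ p, F p ∂(m i).prod (m j) := by
  rw [Measure.prod_sum, lintegral_sum_measure, ENNReal.tsum_prod']

theorem lintegral_sum_prod_sum_prod_sum (m : ℕ → Measure E) [∀ i, SFinite (m i)]
    (F : E × E × E → ℝ≥0∞) :
    ∫⁻ p, F p ∂(Measure.sum m).prod ((Measure.sum m).prod (Measure.sum m))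
      = ∑' i, ∑' j, ∑' k, ∫⁻ p, F p ∂(m i).prod ((m j).prod (m k)) := by
  rw [Measure.prod_sum m m, Measure.prod_sum, lintegral_sum_measure, ENNReal.tsum_prod']
  simp_rw [ENNReal.tsum_prod']

end ProductKernels

/-! ### Factorial cumulant and moment measures of a Poisson cluster process -/

section ClusterMeasures

variable {X E : Type*} [MeasurableSpace X] [MeasurableSpace E] (ρ : Measure X) (η : Kernel X E)

/-- The second factorial cumulant measure of the Poisson cluster process with mark intensity `ρ`
and clusters `η`. -/
def clusterCumulant2 : Measure (E × E) := (ρ.bind (η ×ₖ η)).restrict offDiag2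

/-- The third factorial cumulant measure of the Poisson cluster process with mark intensity `ρ`
and clusters `η`. -/
def clusterCumulant3 : Measure (E × E × E) := (ρ.bind (η ×ₖ (η ×ₖ η))).restrict offDiag3

/-- The second factorial moment measure of the Poisson cluster process: both points lie in one
cluster, or they lie in two. -/
def clusterMoment2 : Measure (E × E) :=
  clusterCumulant2 ρ η + (ρ.bind η).prod (ρ.bind η)

/-- The part of the third factorial moment measure of the Poisson cluster process which comes from
triples that do not belong to a single cluster. -/
def clusterMixed3 : Measure (E × E × E) :=
  ((clusterCumulant2 ρ η).prod (ρ.bind η)).map (fun q => (q.1.1, q.1.2, q.2))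
    + ((clusterCumulant2 ρ η).prod (ρ.bind η)).map (fun q => (q.1.1, q.2, q.1.2))
    + ((clusterCumulant2 ρ η).prod (ρ.bind η)).map (fun q => (q.2, q.1.1, q.1.2))
    + (ρ.bind η).prod ((ρ.bind η).prod (ρ.bind η))

/-- The third factorial moment measure of the Poisson cluster process. -/
def clusterMoment3 : Measure (E × E × E) := clusterCumulant3 ρ η + clusterMixed3 ρ η

variable [IsSFiniteKernel η]

instance [SFinite ρ] : SFinite (clusterCumulant2 ρ η) := by
  unfold clusterCumulant2
  infer_instance

variable [MeasurableEq E]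

theorem lintegral_clusterCumulant2 {F : E × E → ℝ≥0∞} (hF : Measurable F) :
    ∫⁻ p, F p ∂clusterCumulant2 ρ η =
      ∫⁻ z, ∫⁻ p, offDiag2.indicator F p ∂(η z).prod (η z) ∂ρ := by
  rw [clusterCumulant2, ← lintegral_indicator measurableSet_offDiag2,
    Measure.lintegral_bind (Kernel.measurable _).aemeasurable
      (hF.indicator measurableSet_offDiag2).aemeasurable]
  simp_rw [Kernel.prod_apply]

theorem lintegral_clusterCumulant3 {F : E × E × E → ℝ≥0∞} (hF : Measurable F) :
    ∫⁻ p, F p ∂clusterCumulant3 ρ η =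
      ∫⁻ z, ∫⁻ p, offDiag3.indicator F p ∂(η z).prod ((η z).prod (η z)) ∂ρ := by
  rw [clusterCumulant3, ← lintegral_indicator measurableSet_offDiag3,
    Measure.lintegral_bind (Kernel.measurable _).aemeasurable
      (hF.indicator measurableSet_offDiag3).aemeasurable]
  simp_rw [Kernel.prod_apply]

variable [SFinite ρ] [NullSingletonClass (ρ.bind η)]

theorem lintegral_two_clusters {F : E × E → ℝ≥0∞} (hF : Measurable F) :
    ∫⁻ z, ∫⁻ p, offDiag2.indicator F p ∂(η z.1).prod (η z.2) ∂ρ.prod ρ =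
      ∫⁻ p, F p ∂(ρ.bind η).prod (ρ.bind η) := by
  rw [← prod_restrict_offDiag2 (ρ.bind η), ← lintegral_indicator measurableSet_offDiag2,
    bind_prod_bind,
    Measure.lintegral_bind (Kernel.measurable _).aemeasurable
      (hF.indicator measurableSet_offDiag2).aemeasurable]
  simp_rw [Kernel.parallelComp_apply]

theorem lintegral_three_clusters {F : E × E × E → ℝ≥0∞} (hF : Measurable F) :
    ∫⁻ z, ∫⁻ p, offDiag3.indicator F p ∂(η z.1).prod ((η z.2.1).prod (η z.2.2))
        ∂ρ.prod (ρ.prod ρ) =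
      ∫⁻ p, F p ∂(ρ.bind η).prod ((ρ.bind η).prod (ρ.bind η)) := by
  rw [← prod_prod_restrict_offDiag3 (ρ.bind η), ← lintegral_indicator measurableSet_offDiag3,
    bind_prod_bind, bind_prod_bind, Measure.lintegral_bind (Kernel.measurable _).aemeasurable
      (hF.indicator measurableSet_offDiag3).aemeasurable]
  simp_rw [Kernel.parallelComp_apply]

theorem lintegral_pair_single_map {F : E × E × E → ℝ≥0∞} (hF : Measurable F)
    {e : (E × E) × E → E × E × E} (he : Measurable e)
    (mem_offDiag3 : ∀ q, e q ∈ offDiag3 ↔ q.1.1 ≠ q.1.2 ∧ q.1.1 ≠ q.2 ∧ q.1.2 ≠ q.2) :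
    ∫⁻ z, ∫⁻ p, offDiag3.indicator F p ∂(((η z.1).prod (η z.1)).prod (η z.2)).map e ∂ρ.prod ρ =
      ∫⁻ p, F p ∂((clusterCumulant2 ρ η).prod (ρ.bind η)).map e := by
  have hG := hF.indicator (measurableSet_offDiag3 (E := E))
  have restrict_pair : (clusterCumulant2 ρ η).prod (ρ.bind η) =
      ((ρ.bind (η ×ₖ η)).prod (ρ.bind η)).restrict (offDiag2 ×ˢ univ) := by
    rw [clusterCumulant2, ← Measure.prod_restrict, Measure.restrict_univ]
  simp_rw [lintegral_map hG he]
  rw [lintegral_map hF he, restrict_pair,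
    ← lintegral_indicator (measurableSet_offDiag2.prod MeasurableSet.univ)]
  trans ∫⁻ q, offDiag3.indicator F (e q) ∂(ρ.bind (η ×ₖ η)).prod (ρ.bind η)
  · rw [bind_prod_bind, Measure.lintegral_bind (Kernel.measurable _).aemeasurable
      (by exact (hG.comp he).aemeasurable)]
    simp_rw [Kernel.parallelComp_apply, Kernel.prod_apply]
  refine lintegral_congr_ae ?_
  filter_upwards [ae_prod_fst_ne_snd (ρ.bind (η ×ₖ η)) (κ := ρ.bind η) measurable_fst,
    ae_prod_fst_ne_snd (ρ.bind (η ×ₖ η)) (κ := ρ.bind η) measurable_snd] with q h1 h2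
  by_cases h : q.1.1 = q.1.2
  · rw [indicator_of_notMem (fun h' => ((mem_offDiag3 q).1 h').1 h),
      indicator_of_notMem (fun h' => h'.1 h)]
  · rw [indicator_of_mem ((mem_offDiag3 q).2 ⟨h, h1, h2⟩),
      indicator_of_mem (show q ∈ offDiag2 ×ˢ univ from ⟨h, mem_univ _⟩)]

theorem lintegral_clusterMixed3 {F : E × E × E → ℝ≥0∞} (hF : Measurable F) :
    ∫⁻ p, F p ∂clusterMixed3 ρ η =
      ∫⁻ z, (∫⁻ p, offDiag3.indicator F p ∂(η z.1).prod ((η z.1).prod (η z.2))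
          + ∫⁻ p, offDiag3.indicator F p ∂(η z.1).prod ((η z.2).prod (η z.1))
          + ∫⁻ p, offDiag3.indicator F p ∂(η z.2).prod ((η z.1).prod (η z.1))) ∂ρ.prod ρ
        + ∫⁻ z, ∫⁻ p, offDiag3.indicator F p ∂(η z.1).prod ((η z.2.1).prod (η z.2.2))
            ∂ρ.prod (ρ.prod ρ) := by
  have hG := hF.indicator (measurableSet_offDiag3 (E := E))
  have measurable_first_pattern : Measurable fun z : X × X =>
      ∫⁻ p, offDiag3.indicator F p ∂(η z.1).prod ((η z.1).prod (η z.2)) :=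
    measurable_lintegral_prod_prod measurable_fst measurable_fst measurable_snd hG
  have measurable_second_pattern : Measurable fun z : X × X =>
      ∫⁻ p, offDiag3.indicator F p ∂(η z.1).prod ((η z.2).prod (η z.1)) :=
    measurable_lintegral_prod_prod measurable_fst measurable_snd measurable_fst hG
  rw [lintegral_add_left (by exact measurable_first_pattern.add measurable_second_pattern),
    lintegral_add_left measurable_first_pattern, lintegral_three_clusters ρ η hF, clusterMixed3,
    lintegral_add_measure, lintegral_add_measure, lintegral_add_measure]
  congr! 3
  · rw [← lintegral_pair_single_map ρ η hF (by fun_prop) fun q => Iff.rfl]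
    simp_rw [← prod_prod_eq_map_fst_fst]
  · rw [← lintegral_pair_single_map ρ η hF (by fun_prop)
      fun q => by simp only [offDiag3, mem_ofPred_eq]; tauto]
    simp_rw [← prod_prod_eq_map_fst_snd]
  · rw [← lintegral_pair_single_map ρ η hF (by fun_prop)
      fun q => by simp only [offDiag3, mem_ofPred_eq]; tauto]
    simp_rw [← prod_prod_eq_map_snd_fst]

end ClusterMeasures

/-! ### Factorial moments of a superposition of clusters -/

instance {n : ℕ} : Countable (Fin n ↪ ℕ) :=
  (DFunLike.coe_injective (F := Fin n ↪ ℕ)).countable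

theorem measurePreserving_finThreeArrow {X : Type*} [MeasurableSpace X] (ρ : Measure X)
    [SigmaFinite ρ] :
    MeasurePreserving (fun y : Fin 3 → X => (y 0, y 1, y 2)) (Measure.pi fun _ => ρ)
      (ρ.prod (ρ.prod ρ)) :=
  ((MeasurePreserving.id ρ).prod (measurePreserving_finTwoArrow ρ)).comp
    (measurePreserving_piFinSuccAbove (fun _ => ρ) 0)

section Superposition

variable {Ω X E : Type*} [MeasurableSpace Ω] [MeasurableSpace X] [MeasurableSpace E]
  {P : Measure Ω} {Z : ℕ → Ω → X} {ρ : Measure X} {η : Kernel X E}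

/-- The points `Z 0, Z 1, …` have the factorial moment measures `ρ, ρ ⊗ ρ, …` of a Poisson process
with intensity `ρ`. -/
structure HasPoissonFactorialMoments (P : Measure Ω) (Z : ℕ → Ω → X) (ρ : Measure X) : Prop where
  measurable : ∀ j, Measurable (Z j)
  sum_map_embedding : ∀ n : ℕ,
    Measure.sum (fun e : Fin n ↪ ℕ => P.map fun ω k => Z (e k) ω) = Measure.pi fun _ => ρ

/-- The superposition of the clusters `η (z 0), η (z 1), …`, as a kernel in the sequence `z` of
marks. -/
def superposition (η : Kernel X E) : Kernel (ℕ → X) E :=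
  Kernel.sum fun j => η.comap (fun z => z j) (measurable_pi_apply j)

theorem superposition_apply (η : Kernel X E) (z : ℕ → X) :
    superposition η z = Measure.sum fun j => η (z j) := by
  simp only [superposition, Kernel.sum_apply, Kernel.comap_apply]

instance [IsSFiniteKernel η] : IsSFiniteKernel (superposition η) := by
  unfold superposition
  infer_instance

namespace HasPoissonFactorialMoments

theorem lintegral_tsum_embedding (h : HasPoissonFactorialMoments P Z ρ) {n : ℕ}
    {H : (Fin n → X) → ℝ≥0∞} (hH : Measurable H) :
    ∫⁻ ω, ∑' e : Fin n ↪ ℕ, H (fun k => Z (e k) ω) ∂P = ∫⁻ y, H y ∂Measure.pi fun _ => ρ := by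
  have hZ (e : Fin n ↪ ℕ) : Measurable fun ω k => Z (e k) ω :=
    measurable_pi_lambda _ fun k => h.measurable _
  rw [← h.sum_map_embedding, lintegral_sum_measure,
    lintegral_tsum fun e => by exact (hH.comp (hZ e)).aemeasurable]
  congr 1 with e
  rw [lintegral_map hH (hZ e)]

theorem lintegral_tsum (h : HasPoissonFactorialMoments P Z ρ) {H : X → ℝ≥0∞}
    (hH : Measurable H) : ∫⁻ ω, ∑' j, H (Z j ω) ∂P = ∫⁻ z, H z ∂ρ := by
  rw [← (measurePreserving_funUnique ρ (Fin 1)).lintegral_comp hH]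
  exact (lintegral_congr fun ω =>
    (tsum_embedding_one fun y : Fin 1 → ℕ => H (Z (y 0) ω)).symm).trans
      (h.lintegral_tsum_embedding (hH.comp (measurable_pi_apply 0)))

theorem lintegral_superposition (h : HasPoissonFactorialMoments P Z ρ) {F : E → ℝ≥0∞}
    (hF : Measurable F) :
    ∫⁻ ω, ∫⁻ x, F x ∂superposition η (fun j => Z j ω) ∂P = ∫⁻ x, F x ∂ρ.bind η := by
  simp_rw [superposition_apply, lintegral_sum_measure]
  rw [h.lintegral_tsum hF.lintegral_kernel,
    Measure.lintegral_bind η.measurable.aemeasurable hF.aemeasurable]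

variable [SigmaFinite ρ]

theorem lintegral_tsum_embedding_two (h : HasPoissonFactorialMoments P Z ρ) {H : X × X → ℝ≥0∞}
    (hH : Measurable H) :
    ∫⁻ ω, ∑' e : Fin 2 ↪ ℕ, H (Z (e 0) ω, Z (e 1) ω) ∂P = ∫⁻ z, H z ∂ρ.prod ρ := by
  rw [← (measurePreserving_finTwoArrow ρ).lintegral_comp hH]
  exact h.lintegral_tsum_embedding (H := fun y => H (y 0, y 1)) (by fun_prop)

theorem lintegral_tsum_embedding_three (h : HasPoissonFactorialMoments P Z ρ)
    {H : X × X × X → ℝ≥0∞} (hH : Measurable H) :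
    ∫⁻ ω, ∑' e : Fin 3 ↪ ℕ, H (Z (e 0) ω, Z (e 1) ω, Z (e 2) ω) ∂P =
      ∫⁻ z, H z ∂ρ.prod (ρ.prod ρ) := by
  rw [← (measurePreserving_finThreeArrow ρ).lintegral_comp hH]
  exact h.lintegral_tsum_embedding (H := fun y => H (y 0, y 1, y 2)) (by fun_prop)

variable [IsSFiniteKernel η] [MeasurableEq E] [NullSingletonClass (ρ.bind η)]

theorem lintegral_superposition_offDiag2 (h : HasPoissonFactorialMoments P Z ρ)
    {F : E × E → ℝ≥0∞} (hF : Measurable F) :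
    ∫⁻ ω, ∫⁻ p, offDiag2.indicator F p
        ∂(superposition η fun j => Z j ω).prod (superposition η fun j => Z j ω) ∂P =
      ∫⁻ p, F p ∂clusterMoment2 ρ η := by
  have hG := hF.indicator (measurableSet_offDiag2 (E := E))
  have one_cluster : Measurable fun z => ∫⁻ p, offDiag2.indicator F p ∂(η z).prod (η z) :=
    measurable_lintegral_prod measurable_id measurable_id hG
  have two_clusters : Measurable fun z : X × X =>
      ∫⁻ p, offDiag2.indicator F p ∂(η z.1).prod (η z.2) :=
    measurable_lintegral_prod measurable_fst measurable_snd hG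
  simp_rw [superposition_apply, lintegral_sum_prod_sum, tsum_eq_add_tsum_embedding_two]
  rw [lintegral_add_left (by exact Measurable.tsum fun i => one_cluster.comp (h.measurable i)),
    h.lintegral_tsum one_cluster, h.lintegral_tsum_embedding_two two_clusters,
    lintegral_two_clusters ρ η hF, ← lintegral_clusterCumulant2 ρ η hF, clusterMoment2,
    lintegral_add_measure]

theorem lintegral_superposition_offDiag3 (h : HasPoissonFactorialMoments P Z ρ)
    {F : E × E × E → ℝ≥0∞} (hF : Measurable F) :
    ∫⁻ ω, ∫⁻ p, offDiag3.indicator F p ∂(superposition η fun j => Z j ω).prod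
        ((superposition η fun j => Z j ω).prod (superposition η fun j => Z j ω)) ∂P =
      ∫⁻ p, F p ∂clusterMoment3 ρ η := by
  have hG := hF.indicator (measurableSet_offDiag3 (E := E))
  have one_cluster :
      Measurable fun z => ∫⁻ p, offDiag3.indicator F p ∂(η z).prod ((η z).prod (η z)) :=
    measurable_lintegral_prod_prod measurable_id measurable_id measurable_id hG
  have two_clusters : Measurable fun z : X × X =>
      ∫⁻ p, offDiag3.indicator F p ∂(η z.1).prod ((η z.1).prod (η z.2))
        + ∫⁻ p, offDiag3.indicator F p ∂(η z.1).prod ((η z.2).prod (η z.1))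
        + ∫⁻ p, offDiag3.indicator F p ∂(η z.2).prod ((η z.1).prod (η z.1)) :=
    ((measurable_lintegral_prod_prod measurable_fst measurable_fst measurable_snd hG).add
      (measurable_lintegral_prod_prod measurable_fst measurable_snd measurable_fst hG)).add
      (measurable_lintegral_prod_prod measurable_snd measurable_fst measurable_fst hG)
  have three_clusters : Measurable fun z : X × X × X =>
      ∫⁻ p, offDiag3.indicator F p ∂(η z.1).prod ((η z.2.1).prod (η z.2.2)) :=
    measurable_lintegral_prod_prod measurable_fst (by fun_prop) (by fun_prop) hG
  have tsum_one_cluster : Measurable fun ω =>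
      ∑' j, ∫⁻ p, offDiag3.indicator F p ∂(η (Z j ω)).prod ((η (Z j ω)).prod (η (Z j ω))) :=
    Measurable.tsum fun j => one_cluster.comp (h.measurable j)
  simp_rw [superposition_apply, lintegral_sum_prod_sum_prod_sum, tsum_eq_add_tsum_embedding_three]
  rw [lintegral_add_left (by exact tsum_one_cluster.add (Measurable.tsum fun e =>
      two_clusters.comp ((h.measurable (e 0)).prodMk (h.measurable (e 1))))),
    lintegral_add_left tsum_one_cluster, h.lintegral_tsum one_cluster,
    h.lintegral_tsum_embedding_two two_clusters, h.lintegral_tsum_embedding_three three_clusters,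
    ← lintegral_clusterCumulant3 ρ η hF, add_assoc, ← lintegral_clusterMixed3 ρ η hF,
    clusterMoment3, lintegral_add_measure]

end HasPoissonFactorialMoments

end Superposition

/-! ### Simple counting measures and sums over distinct points -/

section SimpleAtomic

/-- A measure on the line which is a countable sum of unit masses at distinct points. -/
structure IsSimpleAtomic (N : Measure ℝ) : Prop where
  countable : (points N).Countable
  compl_null : N (points N)ᶜ = 0
  mass : ∀ x ∈ points N, N {x} = 1

namespace IsSimpleAtomic

variable {N : Measure ℝ}

theorem lintegral_eq (h : IsSimpleAtomic N) (f : ℝ → ℝ≥0∞) :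
    ∫⁻ x, f x ∂N = ∑' a : points N, f a := by
  have restrict_points : N.restrict (points N) = N :=
    Measure.restrict_eq_self_of_ae_mem (mem_ae_iff.2 h.compl_null)
  rw [← restrict_points, lintegral_countable f h.countable, restrict_points]
  congr 1 with a
  rw [h.mass a a.2, mul_one]

variable [SFinite N]

theorem lintegral_offDiag2 (h : IsSimpleAtomic N) {F : ℝ × ℝ → ℝ≥0∞} (hF : Measurable F) :
    ∫⁻ p, offDiag2.indicator F p ∂N.prod N = ∑' e : Fin 2 ↪ points N, F (e 0, e 1) := by
  classical
  rw [lintegral_prod _ (hF.indicator measurableSet_offDiag2).aemeasurable, h.lintegral_eq]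
  simp_rw [h.lintegral_eq]
  rw [tsum_embedding_two fun e : Fin 2 → points N => F (e 0, e 1)]
  congr! 4 with a b
  simp only [indicator_apply, offDiag2, mem_ofPred_eq, ne_eq, ← Subtype.coe_inj]
  congr!

theorem lintegral_offDiag3 (h : IsSimpleAtomic N) {F : ℝ × ℝ × ℝ → ℝ≥0∞} (hF : Measurable F) :
    ∫⁻ p, offDiag3.indicator F p ∂N.prod (N.prod N) =
      ∑' e : Fin 3 ↪ points N, F (e 0, e 1, e 2) := by
  classical
  have hG := hF.indicator (measurableSet_offDiag3 (E := ℝ))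
  have lintegral_last_two (a : ℝ) : ∫⁻ q, offDiag3.indicator F (a, q) ∂N.prod N =
      ∑' b : points N, ∑' c : points N, offDiag3.indicator F (a, b, c) := by
    rw [lintegral_prod (fun q => offDiag3.indicator F (a, q))
      (hG.comp measurable_prodMk_left).aemeasurable, h.lintegral_eq]
    simp_rw [h.lintegral_eq]
  rw [lintegral_prod _ hG.aemeasurable, h.lintegral_eq]
  simp_rw [lintegral_last_two]
  rw [tsum_embedding_three fun e : Fin 3 → points N => F (e 0, e 1, e 2)]
  congr! 6 with a b c
  simp only [indicator_apply, offDiag3, mem_ofPred_eq, ne_eq, ← Subtype.coe_inj]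
  congr!

end IsSimpleAtomic

theorem isSimpleAtomic_finset_sum_dirac (t : Finset ℝ) :
    IsSimpleAtomic (∑ x ∈ t, Measure.dirac x) := by
  have mass (x : ℝ) : (∑ y ∈ t, Measure.dirac y : Measure ℝ) {x} = if x ∈ t then 1 else 0 := by
    rw [Measure.finsetSum_apply]
    simp_rw [Measure.dirac_apply' _ (measurableSet_singleton x)]
    simp [indicator]
  have points_eq : points (∑ x ∈ t, Measure.dirac x) = (t : Set ℝ) := by
    ext x
    simp [points, mass]
  refine ⟨points_eq ▸ t.countable_toSet, ?_, fun x hx => ?_⟩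
  · rw [points_eq, Measure.finsetSum_apply]
    refine Finset.sum_eq_zero fun x hx => ?_
    rw [Measure.dirac_apply' _ t.measurableSet.compl]
    simp [hx]
  · rw [points_eq] at hx
    rw [mass, if_pos (Finset.mem_coe.1 hx)]

theorem isSimpleAtomic_sum {ι : Type*} [Countable ι] {m : ι → Measure ℝ}
    (h : ∀ i, IsSimpleAtomic (m i)) (hd : Pairwise fun i j => ∀ x, m i {x} = 0 ∨ m j {x} = 0) :
    IsSimpleAtomic (Measure.sum m) := by
  have mass (x : ℝ) : Measure.sum m {x} = ∑' i, m i {x} :=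
    Measure.sum_apply _ (measurableSet_singleton x)
  have points_eq : points (Measure.sum m) = ⋃ i, points (m i) := by
    ext x
    simp only [points, mem_ofPred_eq, mass, mem_iUnion, ne_eq, ENNReal.tsum_eq_zero, not_forall]
  have countable : (points (Measure.sum m)).Countable :=
    points_eq ▸ countable_iUnion fun i => (h i).countable
  refine ⟨countable, ?_, fun x hx => ?_⟩
  · rw [Measure.sum_apply _ countable.measurableSet.compl, ENNReal.tsum_eq_zero]
    exact fun i => measure_mono_null
      (compl_subset_compl.2 (points_eq ▸ subset_iUnion (fun i => points (m i)) i))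
      (h i).compl_null
  · rw [points_eq] at hx
    obtain ⟨i, hi⟩ := mem_iUnion.1 hx
    rw [mass, tsum_eq_single i fun j hj => (hd hj.symm x).resolve_left hi, (h i).mass x hi]

end SimpleAtomic

section SumDistinct

theorem sumDistinct_inter {n : ℕ} (A W : Set ℝ) (F : (Fin n → ℝ) → ℝ) :
    sumDistinct (A ∩ W) F = sumDistinct A (indicator {x | ∀ i, x i ∈ W} F) := by
  let inter_equiv : {e : Fin n ↪ A // ∀ i, (e i : ℝ) ∈ W} ≃ (Fin n ↪ (A ∩ W : Set ℝ)) :=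
    { toFun := fun e => ⟨fun i => ⟨e.1 i, (e.1 i).2, e.2 i⟩, fun i j hij =>
        e.1.injective (Subtype.ext (congrArg (fun x : (A ∩ W : Set ℝ) => (x : ℝ)) hij))⟩
      invFun := fun e => ⟨⟨fun i => ⟨e i, (e i).2.1⟩, fun i j hij =>
        e.injective (Subtype.ext (congrArg (fun x : A => (x : ℝ)) hij))⟩, fun i => (e i).2.2⟩
      left_inv := fun e => rfl
      right_inv := fun e => rfl }
  rw [sumDistinct, sumDistinct, ← inter_equiv.tsum_eq]
  exact tsum_subtype {e : Fin n ↪ A | ∀ i, (e i : ℝ) ∈ W} (fun e => F fun i => (e i : ℝ))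

theorem tsum_eq_toReal_sub_toReal {ι : Type*} {f : ι → ℝ}
    (hf : ∑' i, ENNReal.ofReal |f i| ≠ ∞) :
    ∑' i, f i = (∑' i, ENNReal.ofReal (f i)).toReal - (∑' i, ENNReal.ofReal (-f i)).toReal := by
  have hpos : ∑' i, ENNReal.ofReal (f i) ≠ ∞ := ne_top_of_le_ne_top hf
    (ENNReal.tsum_le_tsum fun i => ENNReal.ofReal_le_ofReal (le_abs_self _))
  have hneg : ∑' i, ENNReal.ofReal (-f i) ≠ ∞ := ne_top_of_le_ne_top hf
    (ENNReal.tsum_le_tsum fun i => ENNReal.ofReal_le_ofReal (neg_le_abs _))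
  rw [ENNReal.tsum_toReal_eq fun i => ENNReal.ofReal_ne_top,
    ENNReal.tsum_toReal_eq fun i => ENNReal.ofReal_ne_top,
    ← (ENNReal.summable_toReal hpos).tsum_sub (ENNReal.summable_toReal hneg)]
  congr 1 with i
  rw [ENNReal.toReal_ofReal', ENNReal.toReal_ofReal', max_zero_sub_eq_self]

variable {Ω : Type*} [MeasurableSpace Ω] {P : Measure Ω} {n : ℕ} {A : Ω → Set ℝ}
  {M : Measure (Fin n → ℝ)}

/-- `M` is the `n`-th factorial moment measure of the random set `A`, in the form of Campbell's
formula for nonnegative functions. -/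
def IsFactorialMomentMeasure (P : Measure Ω) (A : Ω → Set ℝ) (M : Measure (Fin n → ℝ)) : Prop :=
  ∀ F : (Fin n → ℝ) → ℝ≥0∞, Measurable F →
    AEMeasurable (fun ω => ∑' e : Fin n ↪ A ω, F fun i => e i) P ∧
      ∫⁻ ω, ∑' e : Fin n ↪ A ω, F (fun i => e i) ∂P = ∫⁻ x, F x ∂M

theorem IsFactorialMomentMeasure.integrable_sumDistinct_and_integral_eq
    (hA : IsFactorialMomentMeasure P A M) {f : (Fin n → ℝ) → ℝ} (hf : Measurable f)
    (hfi : Integrable f M) :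
    Integrable (fun ω => sumDistinct (A ω) f) P ∧
      ∫ ω, sumDistinct (A ω) f ∂P = ∫ x, f x ∂M := by
  obtain ⟨pos_meas, pos_eq⟩ := hA (fun x => ENNReal.ofReal (f x)) (by fun_prop)
  obtain ⟨neg_meas, neg_eq⟩ := hA (fun x => ENNReal.ofReal (-f x)) (by fun_prop)
  obtain ⟨abs_meas, abs_eq⟩ := hA (fun x => ENNReal.ofReal |f x|) (by fun_prop)
  have abs_ne_top : ∫⁻ x, ENNReal.ofReal |f x| ∂M ≠ ∞ := by
    simpa only [HasFiniteIntegral, ← ofReal_norm, Real.norm_eq_abs] using hfi.hasFiniteIntegral.ne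
  have pos_ne_top : ∫⁻ ω, ∑' e : Fin n ↪ A ω, ENNReal.ofReal (f fun i => e i) ∂P ≠ ∞ :=
    pos_eq ▸ ne_top_of_le_ne_top abs_ne_top
      (lintegral_mono fun i => ENNReal.ofReal_le_ofReal (le_abs_self _))
  have neg_ne_top : ∫⁻ ω, ∑' e : Fin n ↪ A ω, ENNReal.ofReal (-f fun i => e i) ∂P ≠ ∞ :=
    neg_eq ▸ ne_top_of_le_ne_top abs_ne_top
      (lintegral_mono fun i => ENNReal.ofReal_le_ofReal (neg_le_abs _))
  have ae_eq : (fun ω => (∑' e : Fin n ↪ A ω, ENNReal.ofReal (f fun i => e i)).toReal -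
      (∑' e : Fin n ↪ A ω, ENNReal.ofReal (-f fun i => e i)).toReal)
      =ᵐ[P] fun ω => sumDistinct (A ω) f := by
    filter_upwards [ae_lt_top' abs_meas (abs_eq ▸ abs_ne_top)] with ω hω
    exact (tsum_eq_toReal_sub_toReal hω.ne).symm
  have pos_int := integrable_toReal_of_lintegral_ne_top pos_meas pos_ne_top
  have neg_int := integrable_toReal_of_lintegral_ne_top neg_meas neg_ne_top
  refine ⟨(pos_int.sub neg_int).congr ae_eq, ?_⟩
  rw [← integral_congr_ae ae_eq, integral_sub pos_int neg_int,
    integral_toReal pos_meas (ae_lt_top' pos_meas pos_ne_top),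
    integral_toReal neg_meas (ae_lt_top' neg_meas neg_ne_top), pos_eq, neg_eq,
    integral_eq_lintegral_pos_part_sub_lintegral_neg_part hfi]

theorem IsFactorialMomentMeasure.integrable_sumDistinct_and_integral_eq_of_map {Y : Type*}
    [MeasurableSpace Y] {M : Measure Y} {v : Y → Fin n → ℝ} (hv : Measurable v)
    (hA : IsFactorialMomentMeasure P A (M.map v)) {f : (Fin n → ℝ) → ℝ} (hf : Measurable f)
    (hfi : Integrable (fun y => f (v y)) M) :
    Integrable (fun ω => sumDistinct (A ω) f) P ∧
      ∫ ω, sumDistinct (A ω) f ∂P = ∫ y, f (v y) ∂M := by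
  rw [← integral_map hv.aemeasurable hf.aestronglyMeasurable]
  exact hA.integrable_sumDistinct_and_integral_eq hf
    ((integrable_map_measure hf.aestronglyMeasurable hv.aemeasurable).2 hfi)

end SumDistinct

/-! ### Signed and translated clusters -/

theorem isSFiniteKernel_of_forall_lt_top {X Y : Type*} [MeasurableSpace X] [MeasurableSpace Y]
    {κ : Kernel X Y} (h : ∀ x, κ x univ < ∞) : IsSFiniteKernel κ := by
  classical
  have level_measurable : Measurable fun x => ⌊(κ x univ).toNNReal⌋₊ :=
    Nat.measurable_floor.comp (κ.measurable_coe MeasurableSet.univ).ennreal_toNNReal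
  let piece (n : ℕ) : Kernel X Y :=
    Kernel.piecewise (level_measurable (measurableSet_singleton n)) κ 0
  have piece_apply (n : ℕ) (x : X) :
      piece n x = if ⌊(κ x univ).toNNReal⌋₊ = n then κ x else 0 := by
    simp only [piece, Kernel.piecewise_apply, mem_preimage, mem_singleton_iff,
      FunLike.coe_zero, Pi.zero_apply]
  have (n : ℕ) : IsFiniteKernel (piece n) := by
    refine ⟨(n + 1 : ℝ≥0), ENNReal.coe_lt_top, fun x => ?_⟩
    rw [piece_apply]
    split_ifs with hx
    · rw [← ENNReal.coe_toNNReal (h x).ne, ENNReal.coe_le_coe, ← hx]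
      exact (Nat.lt_floor_add_one _).le
    · simp
  refine ⟨piece, inferInstance, ?_⟩
  ext x : 1
  rw [Kernel.sum_apply]
  ext s hs
  rw [Measure.sum_apply _ hs, tsum_eq_single ⌊(κ x univ).toNNReal⌋₊, piece_apply, if_pos rfl]
  intro n hn
  rw [piece_apply, if_neg hn.symm, Measure.coe_zero, Pi.zero_apply]

/-- The identity kernel on measures, set to zero on infinite measures so that it is s-finite. -/
def truncKernel : Kernel (Measure ℝ) ℝ where
  toFun μ := if μ univ < ∞ then μ else 0
  measurable' := Measurable.ite
    (measurableSet_lt (Measure.measurable_coe MeasurableSet.univ) measurable_const)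
    measurable_id measurable_const

theorem truncKernel_of_finite {μ : Measure ℝ} (h : μ univ < ∞) : truncKernel μ = μ := if_pos h

theorem truncKernel_of_not_finite {μ : Measure ℝ} (h : ¬μ univ < ∞) : truncKernel μ = 0 := if_neg h

theorem truncKernel_univ_le (μ : Measure ℝ) : truncKernel μ univ ≤ μ univ := by
  by_cases h : μ univ < ∞
  · rw [truncKernel_of_finite h]
  · rw [truncKernel_of_not_finite h]
    exact zero_le

instance : IsSFiniteKernel truncKernel :=
  isSFiniteKernel_of_forall_lt_top fun μ => by
    by_cases h : μ univ < ∞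
    · rwa [truncKernel_of_finite h]
    · simp [truncKernel_of_not_finite h]

/-- The cluster `s • μ` translated by `u`, as a kernel in the mark `(u, μ, s)`. -/
def clusterKernel : Kernel (ℝ × Measure ℝ × ℝ) ℝ :=
  (Kernel.id ×ₖ (truncKernel.comap (fun z : ℝ × Measure ℝ × ℝ => z.2.1) (by fun_prop))).map
    fun q : (ℝ × Measure ℝ × ℝ) × ℝ => q.1.2.2 * q.2 + q.1.1

instance : IsSFiniteKernel clusterKernel := by
  unfold clusterKernel
  infer_instance

theorem clusterKernel_apply (z : ℝ × Measure ℝ × ℝ) :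
    clusterKernel z = (truncKernel z.2.1).map fun x => z.2.2 * x + z.1 := by
  rw [clusterKernel, Kernel.map_apply _ (by fun_prop), Kernel.prod_apply, Kernel.id_apply,
    Kernel.comap_apply, Measure.dirac_prod, Measure.map_map (by fun_prop) (by fun_prop)]
  rfl

theorem clusterKernel_univ (z : ℝ × Measure ℝ × ℝ) :
    clusterKernel z univ = truncKernel z.2.1 univ := by
  rw [clusterKernel_apply, Measure.map_apply (by fun_prop) MeasurableSet.univ, preimage_univ]

theorem IsFiniteSimpleCounting.measure_univ_lt_top {μ : Measure ℝ}
    (h : IsFiniteSimpleCounting μ) : μ univ < ∞ := by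
  obtain ⟨t, rfl⟩ := h
  exact measure_lt_top _ _

theorem isSimpleAtomic_clusterKernel {z : ℝ × Measure ℝ × ℝ} (hμ : IsFiniteSimpleCounting z.2.1)
    (hs : z.2.2 ≠ 0) : IsSimpleAtomic (clusterKernel z) := by
  have injective : Function.Injective fun x => z.2.2 * x + z.1 := fun x y hxy => by
    simpa [hs] using hxy
  have measurable : Measurable fun x => z.2.2 * x + z.1 := by fun_prop
  rw [clusterKernel_apply, truncKernel_of_finite hμ.measure_univ_lt_top]
  obtain ⟨t, ht⟩ := hμ
  classical
  rw [ht, Measure.map_finset_sum measurable.aemeasurable]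
  simp_rw [Measure.map_dirac' measurable]
  rw [← Finset.sum_image (f := fun y => Measure.dirac y) (g := fun x => z.2.2 * x + z.1)
    injective.injOn]
  exact isSimpleAtomic_finset_sum_dirac _

section Intensity

variable (ν : ℝ≥0) (Q : Measure (Measure ℝ)) (θ : ℝ)

instance [SigmaFinite Q] : SigmaFinite (markLaw ν Q θ) := by
  unfold markLaw
  infer_instance

/-- The intensity of the cluster process with respect to Lebesgue measure. -/
def clusterRate : ℝ≥0∞ := ∫⁻ q, ν * truncKernel q.1 univ ∂Q.prod (signLaw θ)

section SFinite

variable [SFinite Q]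

theorem lintegral_markLaw {h : ℝ × Measure ℝ × ℝ → ℝ≥0∞} (hh : Measurable h) :
    ∫⁻ z, h z ∂markLaw ν Q θ = ∫⁻ q, ν * (∫⁻ u, h (u, q)) ∂Q.prod (signLaw θ) := by
  rw [markLaw, lintegral_prod_symm _ hh.aemeasurable]
  simp_rw [lintegral_smul_measure, ENNReal.smul_def, smul_eq_mul]

theorem lintegral_clusterKernel_translates (q : Measure ℝ × ℝ) {K : Set ℝ}
    (hK : MeasurableSet K) :
    ∫⁻ u, clusterKernel (u, q) K = volume K * truncKernel q.1 univ := by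
  have apply_eq_lintegral (u : ℝ) :
      clusterKernel (u, q) K = ∫⁻ x, K.indicator 1 (q.2 * x + u) ∂truncKernel q.1 := by
    rw [clusterKernel_apply, ← lintegral_indicator_one hK,
      lintegral_map (measurable_one.indicator hK) (by fun_prop)]
  have measurable_indicator : Measurable fun p : ℝ × ℝ =>
      K.indicator (1 : ℝ → ℝ≥0∞) (q.2 * p.2 + p.1) :=
    (measurable_one.indicator hK).comp (by fun_prop)
  simp_rw [apply_eq_lintegral]
  rw [lintegral_lintegral_swap measurable_indicator.aemeasurable]
  simp_rw [lintegral_add_left_eq_self (K.indicator (1 : ℝ → ℝ≥0∞)), lintegral_indicator_one hK]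
  rw [lintegral_const]

theorem lintegral_clusterKernel_mul_univ_pow {K : Set ℝ} (hK : MeasurableSet K) (k : ℕ) :
    ∫⁻ z, clusterKernel z K * clusterKernel z univ ^ k ∂markLaw ν Q θ =
      (∫⁻ q, ν * truncKernel q.1 univ ^ (k + 1) ∂Q.prod (signLaw θ)) * volume K := by
  have measurable_cluster :
      Measurable fun z => clusterKernel z K * clusterKernel z univ ^ k :=
    (clusterKernel.measurable_coe hK).mul
      ((clusterKernel.measurable_coe MeasurableSet.univ).pow_const k)
  have measurable_mass : Measurable fun q : Measure ℝ × ℝ =>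
      (ν : ℝ≥0∞) * truncKernel q.1 univ ^ (k + 1) :=
    (((truncKernel.measurable_coe MeasurableSet.univ).comp
      measurable_fst).pow_const _).const_mul _
  rw [lintegral_markLaw ν Q θ measurable_cluster, ← lintegral_mul_const _ measurable_mass]
  congr 1 with q
  simp_rw [clusterKernel_univ]
  rw [lintegral_mul_const _
      (by exact (clusterKernel.measurable_coe hK).comp measurable_prodMk_right),
    lintegral_clusterKernel_translates q hK]
  ring

theorem bind_clusterKernel :
    (markLaw ν Q θ).bind clusterKernel = clusterRate ν Q θ • volume := by
  ext K hK
  rw [Measure.bind_apply hK clusterKernel.measurable.aemeasurable, Measure.smul_apply, smul_eq_mul,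
    clusterRate]
  simpa only [pow_zero, mul_one, zero_add, pow_one] using
    lintegral_clusterKernel_mul_univ_pow ν Q θ hK 0

instance : NullSingletonClass ((markLaw ν Q θ).bind clusterKernel) := by
  rw [bind_clusterKernel]
  exact ⟨fun x => by simp⟩

theorem lintegral_clusterKernel_prod {F : ℝ × ℝ → ℝ≥0∞} (hF : Measurable F) :
    ∫⁻ z, ∫⁻ p, F p ∂(clusterKernel z).prod (clusterKernel z) ∂markLaw ν Q θ =
      ∫⁻ q, ν * ∫⁻ p, (∫⁻ u, F (q.2 * p.1 + u, q.2 * p.2 + u))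
        ∂(truncKernel q.1).prod (truncKernel q.1) ∂Q.prod (signLaw θ) := by
  rw [lintegral_markLaw ν Q θ (measurable_lintegral_prod measurable_id' measurable_id' hF)]
  congr! 3 with q
  rw [lintegral_lintegral_swap (by fun_prop)]
  congr 1 with u
  rw [clusterKernel_apply, Measure.map_prod_map _ _ (by fun_prop) (by fun_prop),
    lintegral_map hF (by fun_prop)]
  rfl

theorem clusterCumulant2_markLaw_le {K : Set ℝ} (hK : MeasurableSet K) :
    clusterCumulant2 (markLaw ν Q θ) clusterKernel (K ×ˢ univ) ≤
      (∫⁻ q, ν * truncKernel q.1 univ ^ 2 ∂Q.prod (signLaw θ)) * volume K := by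
  refine (Measure.restrict_apply_le _ _).trans_eq ?_
  rw [Measure.bind_apply (hK.prod MeasurableSet.univ) (Kernel.measurable _).aemeasurable,
    ← lintegral_clusterKernel_mul_univ_pow ν Q θ hK 1]
  simp_rw [Kernel.prod_apply, Measure.prod_prod, pow_one]

theorem clusterCumulant3_markLaw_le {K : Set ℝ} (hK : MeasurableSet K) :
    clusterCumulant3 (markLaw ν Q θ) clusterKernel (K ×ˢ univ) ≤
      (∫⁻ q, ν * truncKernel q.1 univ ^ 3 ∂Q.prod (signLaw θ)) * volume K := by
  refine (Measure.restrict_apply_le _ _).trans_eq ?_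
  rw [Measure.bind_apply (hK.prod MeasurableSet.univ) (Kernel.measurable _).aemeasurable,
    ← lintegral_clusterKernel_mul_univ_pow ν Q θ hK 2]
  simp_rw [Kernel.prod_apply, ← univ_prod_univ (α := ℝ), Measure.prod_prod, pow_two]

end SFinite

variable [IsFiniteMeasure Q]

theorem lintegral_truncKernel_pow_ne_top {n k : ℕ} (h : ∫⁻ μ, (μ univ) ^ n ∂Q < ∞) (hk : k ≤ n) :
    ∫⁻ q, ν * (truncKernel q.1 univ) ^ k ∂Q.prod (signLaw θ) ≠ ∞ := by
  have measurable_pow : Measurable fun μ : Measure ℝ => truncKernel μ univ ^ k :=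
    (truncKernel.measurable_coe MeasurableSet.univ).pow_const k
  have pow_le (μ : Measure ℝ) : truncKernel μ univ ^ k ≤ 1 + (μ univ) ^ n := by
    rcases le_total (truncKernel μ univ) 1 with h1 | h1
    · exact (pow_le_one' h1 k).trans le_self_add
    · exact ((pow_le_pow_right₀ h1 hk).trans
        (pow_le_pow_left' (truncKernel_univ_le μ) n)).trans le_add_self
  have moment_ne_top : ∫⁻ μ, truncKernel μ univ ^ k ∂Q ≠ ∞ := by
    refine ne_top_of_le_ne_top ?_ (lintegral_mono pow_le)
    rw [lintegral_add_left measurable_const, lintegral_const, one_mul]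
    exact ENNReal.add_ne_top.2 ⟨measure_ne_top _ _, h.ne⟩
  rw [lintegral_prod _ (by exact ((measurable_pow.comp measurable_fst).const_mul _).aemeasurable)]
  simp only [lintegral_const]
  rw [lintegral_mul_const _ (measurable_pow.const_mul _), lintegral_const_mul _ measurable_pow]
  exact ENNReal.mul_ne_top (ENNReal.mul_ne_top ENNReal.coe_ne_top moment_ne_top)
    (measure_ne_top _ _)

theorem clusterRate_ne_top (h : ∫⁻ μ, (μ univ) ^ 3 ∂Q < ∞) : clusterRate ν Q θ ≠ ∞ := by
  simpa only [clusterRate, pow_one] using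
    lintegral_truncKernel_pow_ne_top ν Q θ h (k := 1) (by norm_num)

theorem clusterCumulant2_markLaw_ne_top (h : ∫⁻ μ, (μ univ) ^ 3 ∂Q < ∞) {K : Set ℝ}
    (hK : MeasurableSet K) (hfin : volume K ≠ ∞) :
    clusterCumulant2 (markLaw ν Q θ) clusterKernel (K ×ˢ univ) ≠ ∞ :=
  ne_top_of_le_ne_top
    (ENNReal.mul_ne_top (lintegral_truncKernel_pow_ne_top ν Q θ h (by norm_num)) hfin)
    (clusterCumulant2_markLaw_le ν Q θ hK)

theorem clusterCumulant3_markLaw_ne_top (h : ∫⁻ μ, (μ univ) ^ 3 ∂Q < ∞) {K : Set ℝ}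
    (hK : MeasurableSet K) (hfin : volume K ≠ ∞) :
    clusterCumulant3 (markLaw ν Q θ) clusterKernel (K ×ˢ univ) ≠ ∞ :=
  ne_top_of_le_ne_top
    (ENNReal.mul_ne_top (lintegral_truncKernel_pow_ne_top ν Q θ h le_rfl) hfin)
    (clusterCumulant3_markLaw_le ν Q θ hK)

end Intensity

/-! ### Factorial moments of the sign-symmetrized family -/

theorem HasPoissonFactorialMoments.ae_pairwise_disjoint_atoms {Ω X E : Type*} [MeasurableSpace Ω]
    [MeasurableSpace X] [MeasurableSpace E] [MeasurableEq E] {P : Measure Ω} {Z : ℕ → Ω → X}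
    {ρ : Measure X} [SigmaFinite ρ] {η : Kernel X E} [IsSFiniteKernel η]
    [NullSingletonClass (ρ.bind η)] (h : HasPoissonFactorialMoments P Z ρ) :
    ∀ᵐ ω ∂P, Pairwise fun i j => ∀ x, η (Z i ω) {x} = 0 ∨ η (Z j ω) {x} = 0 := by
  have measurable_common : Measurable fun z : X × X => ((η z.1).prod (η z.2)) offDiag2ᶜ := by
    simpa only [lintegral_indicator_one measurableSet_offDiag2.compl] using
      measurable_lintegral_prod (η := η) measurable_fst measurable_snd
        (measurable_one.indicator measurableSet_offDiag2.compl)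
  have no_common : ∀ᵐ ω ∂P, ∑' e : Fin 2 ↪ ℕ,
      ((η (Z (e 0) ω)).prod (η (Z (e 1) ω))) offDiag2ᶜ = 0 := by
    refine (lintegral_eq_zero_iff (Measurable.tsum fun e : Fin 2 ↪ ℕ =>
      measurable_common.comp ((h.measurable (e 0)).prodMk (h.measurable (e 1))))).1 ?_
    refine (h.lintegral_tsum_embedding_two measurable_common).trans ?_
    simp_rw [← Kernel.parallelComp_apply]
    rw [← Measure.bind_apply measurableSet_offDiag2.compl (Kernel.measurable _).aemeasurable,
      ← bind_prod_bind]
    exact mem_ae_iff.1 (ae_prod_fst_ne_snd _ measurable_id)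
  filter_upwards [no_common] with ω hω i j hij x
  have pair_null := ENNReal.tsum_eq_zero.1 hω ⟨![i, j], injective_vec_two.2 hij⟩
  rw [← mul_eq_zero, ← Measure.prod_prod]
  refine measure_mono_null ?_ pair_null
  rintro p ⟨hp1, hp2⟩ hp
  exact hp (hp1.trans hp2.symm)

theorem ae_signLaw_ne_zero (θ : ℝ) : ∀ᵐ s ∂signLaw θ, s ≠ 0 := by
  rw [ae_iff, signLaw, Measure.add_apply, Measure.smul_apply, Measure.smul_apply]
  simp

namespace IsSignedClusterFamily

variable {Ω : Type*} [MeasurableSpace Ω] {P : Measure Ω} {ν : ℝ≥0}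
  {Q : Measure (Measure ℝ)} {U : ℕ → Ω → ℝ} {C : ℕ → Ω → Measure ℝ} {S : ℝ → ℕ → Ω → ℝ} {θ : ℝ}

theorem ae_isFiniteSimpleCounting (h : IsSignedClusterFamily P ν Q θ U C (S θ)) :
    ∀ᵐ ω ∂P, ∀ j, IsFiniteSimpleCounting (C j ω) :=
  ae_all_iff.2 fun j => ae_of_ae_map (h.measurable_cluster j).aemeasurable <| by
    rw [h.law_cluster j]
    exact h.finiteSimple

theorem ae_signedClusterProcess_eq (h : IsSignedClusterFamily P ν Q θ U C (S θ)) :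
    ∀ᵐ ω ∂P, signedClusterProcess U C S θ ω =
      superposition clusterKernel fun j => (U j ω, C j ω, S θ j ω) := by
  filter_upwards [h.ae_isFiniteSimpleCounting] with ω hC
  rw [signedClusterProcess, superposition_apply]
  congr 1 with j
  rw [clusterKernel_apply, truncKernel_of_finite (hC j).measure_univ_lt_top,
    Measure.map_map (by fun_prop) (by fun_prop)]
  rfl

theorem ae_sign_ne_zero (h : IsSignedClusterFamily P ν Q θ U C (S θ)) : ∀ᵐ ω ∂P, ∀ j, S θ j ω ≠ 0 :=
  ae_all_iff.2 fun j => ae_of_ae_map (p := (· ≠ 0)) (h.measurable_sign j).aemeasurable <| by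
    rw [h.law_sign]
    exact ae_signLaw_ne_zero θ

variable [IsProbabilityMeasure P]

theorem hasPoissonFactorialMoments (h : IsSignedClusterFamily P ν Q θ U C (S θ)) :
    HasPoissonFactorialMoments P (fun j ω => (U j ω, C j ω, S θ j ω)) (markLaw ν Q θ) :=
  ⟨h.measurable_mark, h.sum_map_embedding⟩

theorem ae_isSimpleAtomic (h : IsSignedClusterFamily P ν Q θ U C (S θ)) :
    ∀ᵐ ω ∂P, IsSimpleAtomic (superposition clusterKernel fun j => (U j ω, C j ω, S θ j ω)) := by
  have := h.isProbabilityMeasure_clusterLaw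
  filter_upwards [h.ae_isFiniteSimpleCounting, h.ae_sign_ne_zero,
    h.hasPoissonFactorialMoments.ae_pairwise_disjoint_atoms (η := clusterKernel)]
    with ω hC hS disjoint_atoms
  rw [superposition_apply]
  exact isSimpleAtomic_sum (fun j => isSimpleAtomic_clusterKernel (hC j) (hS j)) disjoint_atoms

theorem isFactorialMomentMeasure_one (h : IsSignedClusterFamily P ν Q θ U C (S θ)) :
    IsFactorialMomentMeasure P (fun ω => points (signedClusterProcess U C S θ ω))
      (((markLaw ν Q θ).bind clusterKernel).map fun x => ![x]) := by
  intro F hF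
  have hv : Measurable fun x : ℝ => ![x] := by fun_prop
  have hmarks := h.hasPoissonFactorialMoments
  have campbell : (fun ω => ∫⁻ x, F ![x] ∂superposition clusterKernel
        fun j => (U j ω, C j ω, S θ j ω)) =ᵐ[P]
      fun ω => ∑' e : Fin 1 ↪ points (signedClusterProcess U C S θ ω), F fun i => e i := by
    filter_upwards [h.ae_signedClusterProcess_eq, h.ae_isSimpleAtomic] with ω heq hω
    rw [heq, hω.lintegral_eq,
      tsum_embedding_one fun e : Fin 1 → points (superposition clusterKernel _) =>
        F fun i => e i]
    congr! 3 with a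
    ext i
    fin_cases i
    rfl
  refine ⟨((hF.comp hv).lintegral_kernel.comp
    (measurable_pi_lambda _ hmarks.measurable)).aemeasurable.congr campbell, ?_⟩
  rw [← lintegral_congr_ae campbell, lintegral_map hF hv]
  exact hmarks.lintegral_superposition (hF.comp hv)

theorem isFactorialMomentMeasure_two (h : IsSignedClusterFamily P ν Q θ U C (S θ)) :
    IsFactorialMomentMeasure P (fun ω => points (signedClusterProcess U C S θ ω))
      ((clusterMoment2 (markLaw ν Q θ) clusterKernel).map fun p => ![p.1, p.2]) := by
  intro F hF
  have := h.isProbabilityMeasure_clusterLaw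
  have hv : Measurable fun p : ℝ × ℝ => ![p.1, p.2] := by fun_prop
  have hmarks := h.hasPoissonFactorialMoments
  have campbell : (fun ω => ∫⁻ p, offDiag2.indicator (fun p => F ![p.1, p.2]) p
        ∂(superposition clusterKernel fun j => (U j ω, C j ω, S θ j ω)).prod
          (superposition clusterKernel fun j => (U j ω, C j ω, S θ j ω))) =ᵐ[P]
      fun ω => ∑' e : Fin 2 ↪ points (signedClusterProcess U C S θ ω), F fun i => e i := by
    filter_upwards [h.ae_signedClusterProcess_eq, h.ae_isSimpleAtomic] with ω heq hω
    rw [heq, hω.lintegral_offDiag2 (F := fun p => F ![p.1, p.2]) (hF.comp hv)]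
    congr! 3 with e
    ext i
    fin_cases i <;> rfl
  have measurable_lintegral := ((hF.comp hv).indicator measurableSet_offDiag2).lintegral_kernel
    (κ := superposition clusterKernel ×ₖ superposition clusterKernel)
  simp only [Kernel.prod_apply] at measurable_lintegral
  refine ⟨(measurable_lintegral.comp
    (measurable_pi_lambda _ hmarks.measurable)).aemeasurable.congr campbell, ?_⟩
  rw [← lintegral_congr_ae campbell, lintegral_map hF hv]
  exact hmarks.lintegral_superposition_offDiag2 (hF.comp hv)

theorem isFactorialMomentMeasure_three (h : IsSignedClusterFamily P ν Q θ U C (S θ)) :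
    IsFactorialMomentMeasure P (fun ω => points (signedClusterProcess U C S θ ω))
      ((clusterMoment3 (markLaw ν Q θ) clusterKernel).map fun p => ![p.1, p.2.1, p.2.2]) := by
  intro F hF
  have := h.isProbabilityMeasure_clusterLaw
  have hv : Measurable fun p : ℝ × ℝ × ℝ => ![p.1, p.2.1, p.2.2] := by fun_prop
  have hmarks := h.hasPoissonFactorialMoments
  have campbell : (fun ω => ∫⁻ p, offDiag3.indicator (fun p => F ![p.1, p.2.1, p.2.2]) p
        ∂(superposition clusterKernel fun j => (U j ω, C j ω, S θ j ω)).prod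
          ((superposition clusterKernel fun j => (U j ω, C j ω, S θ j ω)).prod
            (superposition clusterKernel fun j => (U j ω, C j ω, S θ j ω)))) =ᵐ[P]
      fun ω => ∑' e : Fin 3 ↪ points (signedClusterProcess U C S θ ω), F fun i => e i := by
    filter_upwards [h.ae_signedClusterProcess_eq, h.ae_isSimpleAtomic] with ω heq hω
    rw [heq, hω.lintegral_offDiag3 (F := fun p => F ![p.1, p.2.1, p.2.2]) (hF.comp hv)]
    congr! 3 with e
    ext i
    fin_cases i <;> rfl
  have measurable_lintegral := ((hF.comp hv).indicator measurableSet_offDiag3).lintegral_kernel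
    (κ := superposition clusterKernel ×ₖ (superposition clusterKernel ×ₖ
      superposition clusterKernel))
  simp only [Kernel.prod_apply] at measurable_lintegral
  refine ⟨(measurable_lintegral.comp
    (measurable_pi_lambda _ hmarks.measurable)).aemeasurable.congr campbell, ?_⟩
  rw [← lintegral_congr_ae campbell, lintegral_map hF hv]
  exact hmarks.lintegral_superposition_offDiag3 (hF.comp hv)

end IsSignedClusterFamily

/-! ### Moments of product functions -/

section Product

variable {X E : Type*} [MeasurableSpace X] [MeasurableSpace E] {ρ : Measure X} [SFinite ρ]
  {η : Kernel X E} [IsSFiniteKernel η]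

theorem integral_clusterMoment2_mul {f g : E → ℝ} (hf : Integrable f (ρ.bind η))
    (hg : Integrable g (ρ.bind η))
    (hfg : Integrable (fun p : E × E => f p.1 * g p.2) (clusterCumulant2 ρ η)) :
    Integrable (fun p : E × E => f p.1 * g p.2) (clusterMoment2 ρ η) ∧
      ∫ p, f p.1 * g p.2 ∂clusterMoment2 ρ η =
        ∫ p, f p.1 * g p.2 ∂clusterCumulant2 ρ η +
          (∫ x, f x ∂ρ.bind η) * ∫ x, g x ∂ρ.bind η := by
  have hprod := hf.mul_prod hg
  refine ⟨hfg.add_measure hprod, ?_⟩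
  rw [clusterMoment2, integral_add_measure hfg hprod, integral_prod_mul]

theorem integral_clusterCumulant2_prod_map_mul {F : E × E × E → ℝ} (hF : Measurable F)
    {e : (E × E) × E → E × E × E} (he : Measurable e) {f g h : E → ℝ}
    (hFe : ∀ q, F (e q) = f q.1.1 * g q.1.2 * h q.2)
    (hfg : Integrable (fun p : E × E => f p.1 * g p.2) (clusterCumulant2 ρ η))
    (hh : Integrable h (ρ.bind η)) :
    Integrable F (((clusterCumulant2 ρ η).prod (ρ.bind η)).map e) ∧
      ∫ p, F p ∂((clusterCumulant2 ρ η).prod (ρ.bind η)).map e =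
        (∫ p, f p.1 * g p.2 ∂clusterCumulant2 ρ η) * ∫ x, h x ∂ρ.bind η := by
  rw [integrable_map_measure hF.aestronglyMeasurable he.aemeasurable,
    integral_map he.aemeasurable hF.aestronglyMeasurable]
  simp only [Function.comp_def, hFe]
  exact ⟨hfg.mul_prod hh, integral_prod_mul (fun p : E × E => f p.1 * g p.2) h⟩

theorem integral_clusterMixed3_mul {f : Fin 3 → E → ℝ} (hm : ∀ i, Measurable (f i))
    (hf : ∀ i, Integrable (f i) (ρ.bind η))
    (hff : ∀ i j, Integrable (fun p : E × E => f i p.1 * f j p.2) (clusterCumulant2 ρ η)) :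
    Integrable (fun p : E × E × E => f 0 p.1 * f 1 p.2.1 * f 2 p.2.2) (clusterMixed3 ρ η) ∧
      ∫ p, f 0 p.1 * f 1 p.2.1 * f 2 p.2.2 ∂clusterMixed3 ρ η =
        (∫ p, f 0 p.1 * f 1 p.2 ∂clusterCumulant2 ρ η) * (∫ x, f 2 x ∂ρ.bind η) +
        (∫ p, f 0 p.1 * f 2 p.2 ∂clusterCumulant2 ρ η) * (∫ x, f 1 x ∂ρ.bind η) +
        (∫ p, f 1 p.1 * f 2 p.2 ∂clusterCumulant2 ρ η) * (∫ x, f 0 x ∂ρ.bind η) +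
        (∫ x, f 0 x ∂ρ.bind η) * (∫ x, f 1 x ∂ρ.bind η) * ∫ x, f 2 x ∂ρ.bind η := by
  have hF : Measurable fun p : E × E × E => f 0 p.1 * f 1 p.2.1 * f 2 p.2.2 := by fun_prop
  obtain ⟨int01, eq01⟩ := integral_clusterCumulant2_prod_map_mul hF
    (e := fun q => (q.1.1, q.1.2, q.2)) (by fun_prop) (fun q => rfl) (hff 0 1) (hf 2)
  obtain ⟨int02, eq02⟩ := integral_clusterCumulant2_prod_map_mul hF
    (e := fun q => (q.1.1, q.2, q.1.2)) (by fun_prop) (fun q => by ring) (hff 0 2) (hf 1)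
  obtain ⟨int12, eq12⟩ := integral_clusterCumulant2_prod_map_mul hF
    (e := fun q => (q.2, q.1.1, q.1.2)) (by fun_prop) (fun q => by ring) (hff 1 2) (hf 0)
  have int_triple : Integrable (fun p : E × E × E => f 0 p.1 * f 1 p.2.1 * f 2 p.2.2)
      ((ρ.bind η).prod ((ρ.bind η).prod (ρ.bind η))) := by
    simpa only [mul_assoc] using (hf 0).mul_prod ((hf 1).mul_prod (hf 2))
  have eq_triple :
      ∫ p, f 0 p.1 * f 1 p.2.1 * f 2 p.2.2 ∂(ρ.bind η).prod ((ρ.bind η).prod (ρ.bind η)) =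
        (∫ x, f 0 x ∂ρ.bind η) * (∫ x, f 1 x ∂ρ.bind η) * ∫ x, f 2 x ∂ρ.bind η := by
    simp_rw [mul_assoc]
    rw [integral_prod_mul (f 0) fun q : E × E => f 1 q.1 * f 2 q.2, integral_prod_mul]
  have int_pairs := (int01.add_measure int02).add_measure int12
  refine ⟨int_pairs.add_measure int_triple, ?_⟩
  rw [clusterMixed3, integral_add_measure int_pairs int_triple,
    integral_add_measure (int01.add_measure int02) int12, integral_add_measure int01 int02,
    eq01, eq02, eq12, eq_triple]

end Product

/-! ### Reflection of the cumulant measures -/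

section Transport

theorem indicator_offDiag2_map {E E' M : Type*} [Zero M] {f : E → E'} (hf : Function.Injective f)
    (F : E' × E' → M) (p : E × E) :
    offDiag2.indicator F (Prod.map f f p) =
      offDiag2.indicator (fun p => F (Prod.map f f p)) p := by
  have : Prod.map f f ⁻¹' offDiag2 = offDiag2 := by
    ext p
    simp [offDiag2, hf.eq_iff]
  rw [← this]
  rfl

theorem indicator_offDiag3_map {E E' M : Type*} [Zero M] {f : E → E'} (hf : Function.Injective f)
    (F : E' × E' × E' → M) (p : E × E × E) :
    offDiag3.indicator F (Prod.map f (Prod.map f f) p) =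
      offDiag3.indicator (fun p => F (Prod.map f (Prod.map f f) p)) p := by
  have : Prod.map f (Prod.map f f) ⁻¹' offDiag3 = offDiag3 := by
    ext p
    simp [offDiag3, hf.eq_iff]
  rw [← this]
  rfl

variable {X Y E E' : Type*} [MeasurableSpace X] [MeasurableSpace Y] [MeasurableSpace E]
  [MeasurableSpace E']

theorem clusterMixed3_measurePreserving {ρ : Measure X} [SFinite ρ] {η : Kernel X E}
    [IsSFiniteKernel η] {f : E → E} (h1 : MeasurePreserving f (ρ.bind η) (ρ.bind η))
    (h2 : MeasurePreserving (Prod.map f f) (clusterCumulant2 ρ η) (clusterCumulant2 ρ η)) :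
    MeasurePreserving (Prod.map f (Prod.map f f)) (clusterMixed3 ρ η) (clusterMixed3 ρ η) := by
  have hR : Measurable (Prod.map f (Prod.map f f)) :=
    h1.measurable.prodMap (h1.measurable.prodMap h1.measurable)
  have pair_invariant {e : (E × E) × E → E × E × E} (he : Measurable e)
      (equivariant : ∀ q, Prod.map f (Prod.map f f) (e q) = e (Prod.map (Prod.map f f) f q)) :
      (((clusterCumulant2 ρ η).prod (ρ.bind η)).map e).map (Prod.map f (Prod.map f f)) =
        ((clusterCumulant2 ρ η).prod (ρ.bind η)).map e := by
    conv_rhs => rw [← (h2.prod h1).map_eq]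
    rw [Measure.map_map hR he, Measure.map_map he (h2.prod h1).measurable]
    exact congrArg (Measure.map · _) (funext equivariant)
  refine ⟨hR, ?_⟩
  rw [clusterMixed3, Measure.map_add _ _ hR, Measure.map_add _ _ hR, Measure.map_add _ _ hR,
    pair_invariant (by fun_prop) (fun q => rfl), pair_invariant (by fun_prop) (fun q => rfl),
    pair_invariant (by fun_prop) (fun q => rfl), (h1.prod (h1.prod h1)).map_eq]

variable [MeasurableEq E] [MeasurableEq E']

theorem clusterCumulant3_map {φ : X → Y} (hφ : Measurable φ) {f : E → E'} (hf : Measurable f)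
    (hinj : Function.Injective f) (ρ : Measure X) {η : Kernel X E} {η' : Kernel Y E'}
    [IsSFiniteKernel η] [IsSFiniteKernel η'] (h : ∀ z, η' (φ z) = (η z).map f) :
    clusterCumulant3 (ρ.map φ) η' =
      (clusterCumulant3 ρ η).map (Prod.map f (Prod.map f f)) := by
  have hR : Measurable (Prod.map f (Prod.map f f)) := by fun_prop
  refine Measure.ext_of_lintegral _ fun F hF => ?_
  have hG := hF.indicator (measurableSet_offDiag3 (E := E'))
  rw [lintegral_map hF hR, lintegral_clusterCumulant3 _ _ hF,
    lintegral_clusterCumulant3 _ _ (by exact hF.comp hR),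
    lintegral_map (measurable_lintegral_prod_prod measurable_id' measurable_id' measurable_id' hG)
      hφ]
  simp_rw [h, Measure.map_prod_map _ _ hf hf, Measure.map_prod_map _ _ hf (hf.prodMap hf),
    lintegral_map hG hR, indicator_offDiag3_map hinj]

theorem clusterCumulant3_smul_add_smul (a b : ℝ≥0∞) (ρ ρ' : Measure X) (η : Kernel X E)
    [IsSFiniteKernel η] :
    clusterCumulant3 (a • ρ + b • ρ') η =
      a • clusterCumulant3 ρ η + b • clusterCumulant3 ρ' η := by
  refine Measure.ext_of_lintegral _ fun F hF => ?_
  simp only [lintegral_add_measure, lintegral_smul_measure, lintegral_clusterCumulant3 _ _ hF]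

end Transport

section Reflection

variable (ν : ℝ≥0) (Q : Measure (Measure ℝ)) [SFinite Q] (θ T : ℝ)

instance : SFinite (markLaw ν Q θ) := by
  unfold markLaw
  infer_instance

/-- Reflection of a triple of points in the window `[0, T]`. -/
def reflect3 : ℝ × ℝ × ℝ → ℝ × ℝ × ℝ := Prod.map (T - ·) (Prod.map (T - ·) (T - ·))

theorem measurable_reflect3 : Measurable (reflect3 T) := by
  unfold reflect3
  fun_prop

theorem measurePreserving_sub_left_bind_clusterKernel :
    MeasurePreserving (T - ·) ((markLaw ν Q θ).bind clusterKernel)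
      ((markLaw ν Q θ).bind clusterKernel) := by
  rw [bind_clusterKernel]
  exact (Measure.measurePreserving_sub_left volume T).smul_measure _

/-- The second cumulant measure is stationary and exchangeable: reflecting a pair amounts to
swapping its points and translating by `T - x - y`. -/
theorem measurePreserving_sub_left_clusterCumulant2 :
    MeasurePreserving (Prod.map (T - ·) (T - ·))
      (clusterCumulant2 (markLaw ν Q θ) clusterKernel)
      (clusterCumulant2 (markLaw ν Q θ) clusterKernel) := by
  have hR : Measurable (Prod.map (T - · : ℝ → ℝ) (T - ·)) := by fun_prop
  refine ⟨hR, Measure.ext_of_lintegral _ fun F hF => ?_⟩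
  have hG := hF.indicator (measurableSet_offDiag2 (E := ℝ))
  rw [lintegral_map hF hR, lintegral_clusterCumulant2 _ _ (by exact hF.comp hR),
    lintegral_clusterCumulant2 _ _ hF]
  simp_rw [← indicator_offDiag2_map (f := (T - · : ℝ → ℝ)) sub_right_injective F]
  rw [lintegral_clusterKernel_prod _ _ _ hG,
    lintegral_clusterKernel_prod _ _ _ (by exact hG.comp hR)]
  congr! 3 with q
  rw [← lintegral_prod_swap]
  congr 1 with p
  rw [← lintegral_sub_left_eq_self _ (T - q.2 * p.1 - q.2 * p.2)]
  congr 1 with u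
  congr 1
  ext
  · simp only [Prod.map_fst, Prod.fst_swap]
    ring
  · simp only [Prod.map_snd, Prod.snd_swap]
    ring

theorem measurePreserving_reflect3_clusterMixed3 :
    MeasurePreserving (reflect3 T) (clusterMixed3 (markLaw ν Q θ) clusterKernel)
      (clusterMixed3 (markLaw ν Q θ) clusterKernel) :=
  clusterMixed3_measurePreserving (measurePreserving_sub_left_bind_clusterKernel ν Q θ T)
    (measurePreserving_sub_left_clusterCumulant2 ν Q θ T)

theorem measurePreserving_neg_signLaw :
    MeasurePreserving Neg.neg (signLaw θ) (signLaw (-θ)) := by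
  refine ⟨measurable_neg, ?_⟩
  rw [signLaw, signLaw, Measure.map_add _ _ measurable_neg, Measure.map_smul, Measure.map_smul,
    Measure.map_dirac' measurable_neg, Measure.map_dirac' measurable_neg, neg_neg, add_comm,
    sub_neg_eq_add, ← sub_eq_add_neg]

theorem measurePreserving_reflect_markLaw :
    MeasurePreserving (Prod.map (T - ·) (Prod.map id Neg.neg)) (markLaw ν Q θ)
      (markLaw ν Q (-θ)) :=
  ((Measure.measurePreserving_sub_left volume T).smul_measure _).prod
    ((MeasurePreserving.id Q).prod (measurePreserving_neg_signLaw θ))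

theorem clusterKernel_reflect (z : ℝ × Measure ℝ × ℝ) :
    clusterKernel (Prod.map (T - ·) (Prod.map id Neg.neg) z) =
      (clusterKernel z).map (T - ·) := by
  rw [clusterKernel_apply, clusterKernel_apply, Measure.map_map (by fun_prop) (by fun_prop)]
  congr 1
  ext x
  simp only [Prod.map_fst, Prod.map_snd, Function.comp_apply]
  ring

theorem clusterCumulant3_markLaw_neg :
    clusterCumulant3 (markLaw ν Q (-θ)) clusterKernel =
      (clusterCumulant3 (markLaw ν Q θ) clusterKernel).map (reflect3 T) := by
  have reflect := measurePreserving_reflect_markLaw ν Q θ T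
  rw [← reflect.map_eq]
  exact clusterCumulant3_map reflect.measurable (by fun_prop) sub_right_injective _
    (clusterKernel_reflect T)

theorem signLaw_eq_mixture :
    signLaw θ = ENNReal.ofReal ((1 + θ) / 2) • signLaw 1 +
      ENNReal.ofReal ((1 - θ) / 2) • signLaw (-1) := by
  simp [signLaw]

theorem markLaw_eq_mixture :
    markLaw ν Q θ = ENNReal.ofReal ((1 + θ) / 2) • markLaw ν Q 1 +
      ENNReal.ofReal ((1 - θ) / 2) • markLaw ν Q (-1) := by
  simp only [markLaw]
  rw [signLaw_eq_mixture θ]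
  simp only [Measure.prod_add, Measure.prod_smul_right]

theorem clusterCumulant3_markLaw_eq_mixture :
    clusterCumulant3 (markLaw ν Q θ) clusterKernel =
      ENNReal.ofReal ((1 + θ) / 2) • clusterCumulant3 (markLaw ν Q 1) clusterKernel +
      ENNReal.ofReal ((1 - θ) / 2) •
        (clusterCumulant3 (markLaw ν Q 1) clusterKernel).map (reflect3 T) := by
  rw [← clusterCumulant3_markLaw_neg, ← clusterCumulant3_smul_add_smul, ← markLaw_eq_mixture]

end Reflection

theorem integral_eq_zero_of_comp_eq_neg {α : Type*} [MeasurableSpace α] {M : Measure α}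
    {R : α → α} (hR : MeasurePreserving R M M) {F : α → ℝ} (hFm : AEStronglyMeasurable F M)
    (hF : ∀ p, F (R p) = -F p) : ∫ p, F p ∂M = 0 := by
  have invariant : ∫ p, F p ∂M = ∫ p, F (R p) ∂M := by
    rw [← integral_map hR.aemeasurable (hR.map_eq.symm ▸ hFm), hR.map_eq]
  simp_rw [hF, integral_neg] at invariant
  linarith

theorem integral_clusterCumulant3_markLaw {ν : ℝ≥0} {Q : Measure (Measure ℝ)} [SFinite Q]
    {θ T : ℝ} (hθ : θ ∈ Icc (-1 : ℝ) 1) {F : ℝ × ℝ × ℝ → ℝ} (hFm : Measurable F)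
    (hF : ∀ p, F (reflect3 T p) = -F p)
    (hi : Integrable F (clusterCumulant3 (markLaw ν Q 1) clusterKernel)) :
    ∫ p, F p ∂clusterCumulant3 (markLaw ν Q θ) clusterKernel =
      θ * ∫ p, F p ∂clusterCumulant3 (markLaw ν Q 1) clusterKernel := by
  have hR := measurable_reflect3 T
  have hi_reflect :
      Integrable F ((clusterCumulant3 (markLaw ν Q 1) clusterKernel).map (reflect3 T)) := by
    rw [integrable_map_measure hFm.aestronglyMeasurable hR.aemeasurable]
    exact hi.neg.congr (Eventually.of_forall fun p => (hF p).symm)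
  rw [clusterCumulant3_markLaw_eq_mixture ν Q θ T, integral_add_measure
    (hi.smul_measure ENNReal.ofReal_ne_top) (hi_reflect.smul_measure ENNReal.ofReal_ne_top),
    integral_smul_measure, integral_smul_measure,
    integral_map hR.aemeasurable hFm.aestronglyMeasurable]
  simp_rw [hF, integral_neg]
  rw [ENNReal.toReal_ofReal (by linarith [hθ.1]), ENNReal.toReal_ofReal (by linarith [hθ.2]),
    smul_eq_mul, smul_eq_mul]
  ring

/-! ### Test functions on strips -/

section Strip

variable {X Y : Type*} [TopologicalSpace X] [MeasurableSpace X] [MeasurableSpace Y]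

/-- Bounded measurable functions on `X × Y` vanishing off a strip `K × Y` with `K` compact. A
third cumulant measure need not be controlled in any other way at infinity: it is finite on strips,
and this is the class of functions it integrates. -/
structure IsStripTestFunction (F : X × Y → ℝ) : Prop where
  measurable : Measurable F
  bounded : ∃ B : ℝ, ∀ p, |F p| ≤ B
  support : ∃ K, IsCompact K ∧ ∀ p, p.1 ∉ K → F p = 0

/-- Measures on `X × Y` that are finite on the strips `K × Y` with `K` compact. -/
def IsStripFinite (M : Measure (X × Y)) : Prop := ∀ K, IsCompact K → M (K ×ˢ univ) ≠ ∞

theorem IsStripTestFunction.integrable {F : X × Y → ℝ} (hF : IsStripTestFunction F)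
    {M : Measure (X × Y)} (hM : IsStripFinite M) : Integrable F M := by
  obtain ⟨B, hB⟩ := hF.bounded
  obtain ⟨K, hK, hFK⟩ := hF.support
  have support_subset : Function.support F ⊆ K ×ˢ univ := fun p hp =>
    ⟨by_contra fun hpK => hp (hFK p hpK), mem_univ _⟩
  exact (integrableOn_iff_integrable_of_support_subset support_subset).1
    (Measure.integrableOn_of_bounded (hM K hK) hF.measurable.aestronglyMeasurable
      (Eventually.of_forall hB))

theorem IsStripFinite.add {M M' : Measure (X × Y)} (hM : IsStripFinite M)
    (hM' : IsStripFinite M') : IsStripFinite (M + M') := fun K hK =>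
  ENNReal.add_ne_top.2 ⟨hM K hK, hM' K hK⟩

theorem IsTestFunction.isStripTestFunction_mul {f : X → ℝ} (hf : IsTestFunction f) {G : Y → ℝ}
    (hG : Measurable G) (hGb : ∃ B : ℝ, ∀ y, |G y| ≤ B) :
    IsStripTestFunction fun p : X × Y => f p.1 * G p.2 := by
  obtain ⟨A, hA⟩ := hf.bounded
  obtain ⟨B, hB⟩ := hGb
  refine ⟨(hf.measurable.comp measurable_fst).mul (hG.comp measurable_snd),
    ⟨A * B, fun p => ?_⟩, tsupport f, hf.compactSupport, fun p hp => ?_⟩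
  · rw [abs_mul]
    exact mul_le_mul (hA _) (hB _) (abs_nonneg _) ((abs_nonneg _).trans (hA p.1))
  · rw [image_eq_zero_of_notMem_tsupport hp, zero_mul]

theorem isStripTestFunction_mul_mul {X Y Z : Type*} [TopologicalSpace X] [MeasurableSpace X]
    [TopologicalSpace Y] [MeasurableSpace Y] [TopologicalSpace Z] [MeasurableSpace Z]
    {f : X → ℝ} {g : Y → ℝ} {h : Z → ℝ} (hf : IsTestFunction f) (hg : IsTestFunction g)
    (hh : IsTestFunction h) :
    IsStripTestFunction fun p : X × Y × Z => f p.1 * g p.2.1 * h p.2.2 := by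
  have hgh := hg.isStripTestFunction_mul hh.measurable hh.bounded
  simpa only [mul_assoc] using hf.isStripTestFunction_mul hgh.measurable hgh.bounded

theorem isTestFunction_indicator_one [R1Space X] {A K : Set X} (hA : MeasurableSet A)
    (hK : IsCompact K) (hAK : A ⊆ K) : IsTestFunction (A.indicator (1 : X → ℝ)) := by
  refine ⟨measurable_one.indicator hA, ⟨1, fun x => ?_⟩,
    HasCompactSupport.intro hK fun x hx => indicator_of_notMem (fun h => hx (hAK h)) _⟩
  by_cases hx : x ∈ A <;> simp [hx]

/-- Indicators of boxes are products of test functions, and boxes generate the σ-algebra. -/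
theorem IsStripFinite.ext_of_integral_mul_mul {M M' : Measure (ℝ × ℝ × ℝ)} (hM : IsStripFinite M)
    (hM' : IsStripFinite M') (h : ∀ f : Fin 3 → ℝ → ℝ, (∀ i, IsTestFunction (f i)) →
      ∫ p, f 0 p.1 * f 1 p.2.1 * f 2 p.2.2 ∂M = ∫ p, f 0 p.1 * f 1 p.2.1 * f 2 p.2.2 ∂M') :
    M = M' := by
  let K (n : ℕ) : Set ℝ := Icc (-(n : ℝ)) n
  have hK (n : ℕ) : IsCompact (K n) := isCompact_Icc
  have iUnion_cube : ⋃ n, K n ×ˢ K n ×ˢ K n = univ := by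
    refine eq_univ_of_forall fun p => ?_
    obtain ⟨n, hn⟩ := exists_nat_ge (max |p.1| (max |p.2.1| |p.2.2|))
    simp only [max_le_iff] at hn
    exact mem_iUnion.2 ⟨n, abs_le.1 hn.1, abs_le.1 hn.2.1, abs_le.1 hn.2.2⟩
  refine Measure.ext_of_iUnion_eq_univ iUnion_cube fun n => ?_
  have subset_strip {s : Set ℝ} {t : Set (ℝ × ℝ)} (hs : s ⊆ K n) : s ×ˢ t ⊆ K n ×ˢ univ :=
    prod_mono hs (subset_univ _)
  have : IsFiniteMeasure (M.restrict (K n ×ˢ K n ×ˢ K n)) :=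
    ⟨by simpa only [Measure.restrict_apply_univ] using
      (measure_mono (subset_strip subset_rfl)).trans_lt (hM _ (hK n)).lt_top⟩
  refine Measure.ext_prod₃ fun {A₀ A₁ A₂} hA₀ hA₁ hA₂ => ?_
  have hAm := hA₀.prod (hA₁.prod hA₂)
  rw [Measure.restrict_apply hAm, Measure.restrict_apply hAm, prod_inter_prod, prod_inter_prod]
  have inter_meas {A : Set ℝ} (hA : MeasurableSet A) : MeasurableSet (A ∩ K n) :=
    hA.inter (hK n).measurableSet
  have box_eq := h (fun i => (![A₀ ∩ K n, A₁ ∩ K n, A₂ ∩ K n] i).indicator 1) fun i =>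
    isTestFunction_indicator_one (by fin_cases i <;> exact inter_meas ‹_›) (hK n)
      (by fin_cases i <;> exact inter_subset_right)
  have indicator_box (p : ℝ × ℝ × ℝ) : (A₀ ∩ K n).indicator (1 : ℝ → ℝ) p.1 *
      (A₁ ∩ K n).indicator (1 : ℝ → ℝ) p.2.1 * (A₂ ∩ K n).indicator (1 : ℝ → ℝ) p.2.2 =
      ((A₀ ∩ K n) ×ˢ (A₁ ∩ K n) ×ˢ (A₂ ∩ K n)).indicator 1 p := by
    rw [mul_assoc, ← indicator_prod_one, ← indicator_prod_one]
  simp only [Matrix.cons_val, indicator_box, integral_indicator_one ((inter_meas hA₀).prod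
    ((inter_meas hA₁).prod (inter_meas hA₂))), measureReal_def] at box_eq
  exact (ENNReal.toReal_eq_toReal_iff'
    (ne_top_of_le_ne_top (hM _ (hK n)) (measure_mono (subset_strip inter_subset_right)))
    (ne_top_of_le_ne_top (hM' _ (hK n)) (measure_mono (subset_strip inter_subset_right)))).1 box_eq

end Strip

section ClusterIntegrability

variable {ν : ℝ≥0} {Q : Measure (Measure ℝ)} [IsFiniteMeasure Q] {θ : ℝ}

theorem isStripFinite_clusterCumulant2_markLaw (h : ∫⁻ μ, (μ univ) ^ 3 ∂Q < ∞) :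
    IsStripFinite (clusterCumulant2 (markLaw ν Q θ) clusterKernel) := fun _ hK =>
  clusterCumulant2_markLaw_ne_top ν Q θ h hK.measurableSet hK.measure_lt_top.ne

theorem isStripFinite_clusterCumulant3_markLaw (h : ∫⁻ μ, (μ univ) ^ 3 ∂Q < ∞) :
    IsStripFinite (clusterCumulant3 (markLaw ν Q θ) clusterKernel) := fun _ hK =>
  clusterCumulant3_markLaw_ne_top ν Q θ h hK.measurableSet hK.measure_lt_top.ne

theorem IsTestFunction.integrable {X : Type*} [TopologicalSpace X] [MeasurableSpace X]
    {f : X → ℝ} (hf : IsTestFunction f) (M : Measure X) [IsFiniteMeasureOnCompacts M] :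
    Integrable f M := by
  obtain ⟨B, hB⟩ := hf.bounded
  exact (integrableOn_iff_integrable_of_support_subset (subset_tsupport f)).1
    (Measure.integrableOn_of_bounded hf.compactSupport.measure_lt_top.ne
      hf.measurable.aestronglyMeasurable (Eventually.of_forall hB))

theorem IsTestFunction.integrable_bind_clusterKernel (h : ∫⁻ μ, (μ univ) ^ 3 ∂Q < ∞) {f : ℝ → ℝ}
    (hf : IsTestFunction f) : Integrable f ((markLaw ν Q θ).bind clusterKernel) := by
  rw [bind_clusterKernel]
  exact (hf.integrable volume).smul_measure (clusterRate_ne_top ν Q θ h)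

end ClusterIntegrability

/-! ### The third factorial cumulant of the sign-symmetrized family -/

namespace IsSignedClusterFamily

variable {Ω : Type*} [MeasurableSpace Ω] {P : Measure Ω} [IsProbabilityMeasure P] {ν : ℝ≥0}
  {Q : Measure (Measure ℝ)} {U : ℕ → Ω → ℝ} {C : ℕ → Ω → Measure ℝ} {S : ℝ → ℕ → Ω → ℝ} {θ : ℝ}
  {f g : ℝ → ℝ}

theorem factorialMoment_one (h : IsSignedClusterFamily P ν Q θ U C (S θ)) (hf : IsTestFunction f) :
    factorialMoment P (signedClusterProcess U C S θ) ![f] =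
      ∫ x, f x ∂(markLaw ν Q θ).bind clusterKernel := by
  have := h.isProbabilityMeasure_clusterLaw
  have hprod : Measurable fun x : Fin 1 → ℝ => f (x 0) :=
    hf.measurable.comp (measurable_pi_apply 0)
  simpa [factorialMoment] using
    (h.isFactorialMomentMeasure_one.integrable_sumDistinct_and_integral_eq_of_map
      (by fun_prop) hprod (hf.integrable_bind_clusterKernel h.thirdMoment)).2

theorem factorialMoment_two (h : IsSignedClusterFamily P ν Q θ U C (S θ))
    (hf : IsTestFunction f) (hg : IsTestFunction g) :
    factorialMoment P (signedClusterProcess U C S θ) ![f, g] =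
      ∫ p, f p.1 * g p.2 ∂clusterCumulant2 (markLaw ν Q θ) clusterKernel +
        (∫ x, f x ∂(markLaw ν Q θ).bind clusterKernel) *
          ∫ x, g x ∂(markLaw ν Q θ).bind clusterKernel := by
  have := h.isProbabilityMeasure_clusterLaw
  have h3 := h.thirdMoment
  obtain ⟨integrable_moment, integral_moment⟩ :=
    integral_clusterMoment2_mul (hf.integrable_bind_clusterKernel h3)
      (hg.integrable_bind_clusterKernel h3)
      ((hf.isStripTestFunction_mul hg.measurable hg.bounded).integrable
        (isStripFinite_clusterCumulant2_markLaw (ν := ν) (θ := θ) h3))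
  have hprod : Measurable fun x : Fin 2 → ℝ => f (x 0) * g (x 1) :=
    (hf.measurable.comp (measurable_pi_apply 0)).mul (hg.measurable.comp (measurable_pi_apply 1))
  rw [← integral_moment]
  simpa [factorialMoment, Fin.prod_univ_two] using
    (h.isFactorialMomentMeasure_two.integrable_sumDistinct_and_integral_eq_of_map
      (by fun_prop) hprod integrable_moment).2

theorem factorialCumulant3_eq (h : IsSignedClusterFamily P ν Q θ U C (S θ))
    {f : Fin 3 → ℝ → ℝ} (hf : ∀ i, IsTestFunction (f i)) :
    factorialCumulant3 P (signedClusterProcess U C S θ) f =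
      ∫ p, f 0 p.1 * f 1 p.2.1 * f 2 p.2.2 ∂clusterCumulant3 (markLaw ν Q θ) clusterKernel := by
  have := h.isProbabilityMeasure_clusterLaw
  have h3 := h.thirdMoment
  have integrable_cumulant := (isStripTestFunction_mul_mul (hf 0) (hf 1) (hf 2)).integrable
    (isStripFinite_clusterCumulant3_markLaw (ν := ν) (θ := θ) h3)
  obtain ⟨integrable_mixed, integral_mixed⟩ :=
    integral_clusterMixed3_mul (ρ := markLaw ν Q θ) (η := clusterKernel)
      (fun i => (hf i).measurable) (fun i => (hf i).integrable_bind_clusterKernel h3)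
      fun i j => ((hf i).isStripTestFunction_mul (hf j).measurable (hf j).bounded).integrable
        (isStripFinite_clusterCumulant2_markLaw h3)
  have hprod : Measurable fun x : Fin 3 → ℝ => f 0 (x 0) * f 1 (x 1) * f 2 (x 2) :=
    (((hf 0).measurable.comp (measurable_pi_apply 0)).mul
      ((hf 1).measurable.comp (measurable_pi_apply 1))).mul
      ((hf 2).measurable.comp (measurable_pi_apply 2))
  have factorialMoment_three :
      factorialMoment P (signedClusterProcess U C S θ) ![f 0, f 1, f 2] =
        ∫ p, f 0 p.1 * f 1 p.2.1 * f 2 p.2.2 ∂clusterMoment3 (markLaw ν Q θ) clusterKernel := by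
    simpa [factorialMoment, Fin.prod_univ_three] using
      (h.isFactorialMomentMeasure_three.integrable_sumDistinct_and_integral_eq_of_map
        (by fun_prop) hprod (integrable_cumulant.add_measure integrable_mixed)).2
  rw [factorialCumulant3, factorialMoment_three, clusterMoment3,
    integral_add_measure integrable_cumulant integrable_mixed, integral_mixed,
    h.factorialMoment_two (hf 0) (hf 1), h.factorialMoment_two (hf 0) (hf 2),
    h.factorialMoment_two (hf 1) (hf 2), h.factorialMoment_one (hf 0),
    h.factorialMoment_one (hf 1), h.factorialMoment_one (hf 2)]
  ring

end IsSignedClusterFamily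

/-! ### Measures with an integrable reduced density -/

section ReducedDensity

/-- The change from reduced coordinates (a base point and two displacements) to the three
points. -/
def shear (q : ℝ × ℝ × ℝ) : ℝ × ℝ × ℝ := (q.1, q.1 + q.2.1, q.1 + q.2.2)

theorem measurable_shear : Measurable shear := by
  unfold shear
  fun_prop

/-- The measure with reduced density the positive part of `c`. A signed density `c` is handled
through the pair `densityMeasure c`, `densityMeasure (-c)`. -/
def densityMeasure (c : ℝ × ℝ → ℝ) : Measure (ℝ × ℝ × ℝ) :=
  ((volume : Measure ℝ).prod (volume.withDensity fun τ => ENNReal.ofReal (c τ))).map shear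

variable {c : ℝ × ℝ → ℝ} {F : ℝ × ℝ × ℝ → ℝ}

theorem isStripFinite_densityMeasure (hc : Integrable c) : IsStripFinite (densityMeasure c) := by
  intro K hK
  have := isFiniteMeasure_withDensity_ofReal hc.hasFiniteIntegral
  have preimage_strip : shear ⁻¹' (K ×ˢ univ) = K ×ˢ univ := by
    ext q
    simp [shear]
  rw [densityMeasure, Measure.map_apply measurable_shear
    (hK.measurableSet.prod MeasurableSet.univ), preimage_strip, Measure.prod_prod]
  exact ENNReal.mul_ne_top hK.measure_lt_top.ne (measure_ne_top _ _)

theorem integral_densityMeasure (hc : AEMeasurable c) (hF : Measurable F) :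
    ∫ p, F p ∂densityMeasure c = ∫ q : ℝ × ℝ × ℝ, F (shear q) * max (c q.2) 0 := by
  have hdens : AEMeasurable (fun q : ℝ × ℝ × ℝ => ENNReal.ofReal (c q.2)) :=
    hc.ennreal_ofReal.comp_snd
  rw [densityMeasure, prod_withDensity_right₀ hc.ennreal_ofReal, ← Measure.volume_eq_prod,
    integral_map measurable_shear.aemeasurable hF.aestronglyMeasurable,
    integral_withDensity_eq_integral_toReal_smul₀ hdens (by simp)]
  simp only [ENNReal.toReal_ofReal', smul_eq_mul, mul_comm]

theorem IsStripTestFunction.integrable_shear_mul (hF : IsStripTestFunction F)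
    (hc : Integrable c) : Integrable fun q : ℝ × ℝ × ℝ => F (shear q) * c q.2 := by
  obtain ⟨B, hB⟩ := hF.bounded
  obtain ⟨K, hK, hFK⟩ := hF.support
  have integrable_strip : Integrable fun q : ℝ × ℝ × ℝ => K.indicator 1 q.1 * c q.2 :=
    ((integrable_indicator_iff hK.measurableSet).2
      (integrableOn_const hK.measure_lt_top.ne)).mul_prod hc
  refine (integrable_strip.bdd_mul (hF.measurable.comp measurable_shear).aestronglyMeasurable
    (Eventually.of_forall fun q => hB (shear q))).congr (Eventually.of_forall fun q => ?_)
  by_cases hq : q.1 ∈ K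
  · simp [hq]
  · simp [hq, hFK (shear q) hq]

theorem IsStripTestFunction.integral_densityMeasure_sub (hF : IsStripTestFunction F)
    (hc : Integrable c) :
    ∫ p, F p ∂densityMeasure c - ∫ p, F p ∂densityMeasure (-c) =
      ∫ q : ℝ × ℝ × ℝ, F (shear q) * c q.2 := by
  rw [integral_densityMeasure hc.aemeasurable hF.measurable,
    integral_densityMeasure hc.neg.aemeasurable hF.measurable,
    ← integral_sub (hF.integrable_shear_mul hc.pos_part) (hF.integrable_shear_mul hc.neg.pos_part)]
  simp only [← mul_sub, Pi.neg_apply, max_zero_sub_eq_self]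

theorem IsStripTestFunction.integral_shear_mul (hF : IsStripTestFunction F) (hc : Integrable c) :
    ∫ q : ℝ × ℝ × ℝ, F (shear q) * c q.2 =
      ∫ t : ℝ, ∫ τ : ℝ × ℝ, F (t, t + τ.1, t + τ.2) * c τ :=
  integral_prod _ (hF.integrable_shear_mul hc)

theorem IsStripFinite.integral_eq_of_reducedDensity {M : Measure (ℝ × ℝ × ℝ)}
    (hM : IsStripFinite M) (hc : Integrable c)
    (h : ∀ f : Fin 3 → ℝ → ℝ, (∀ i, IsTestFunction (f i)) →
      ∫ p, f 0 p.1 * f 1 p.2.1 * f 2 p.2.2 ∂M =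
        ∫ t : ℝ, ∫ τ : ℝ × ℝ, f 0 t * f 1 (t + τ.1) * f 2 (t + τ.2) * c τ)
    (hF : IsStripTestFunction F) :
    ∫ p, F p ∂M = ∫ q : ℝ × ℝ × ℝ, F (shear q) * c q.2 := by
  have hpos := isStripFinite_densityMeasure hc
  have hneg := isStripFinite_densityMeasure hc.neg
  have decomposition : M + densityMeasure (-c) = densityMeasure c := by
    refine (hM.add hneg).ext_of_integral_mul_mul hpos fun f hf => ?_
    have hprod := isStripTestFunction_mul_mul (hf 0) (hf 1) (hf 2)
    rw [integral_add_measure (hprod.integrable hM) (hprod.integrable hneg), h f hf,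
      ← hprod.integral_shear_mul hc, ← hprod.integral_densityMeasure_sub hc, sub_add_cancel]
  rw [← hF.integral_densityMeasure_sub hc, ← decomposition,
    integral_add_measure (hF.integrable hM) (hF.integrable hneg), add_sub_cancel_right]

end ReducedDensity

/-! ### The mean of the odd statistic -/

section OddSummand

variable {T : ℝ} {c g : ℝ × ℝ → ℝ}

/-- The cube `[0, T]³` of triples of points in the observation window. -/
def windowCube (T : ℝ) : Set (ℝ × ℝ × ℝ) := Icc 0 T ×ˢ Icc 0 T ×ˢ Icc 0 T

theorem measurableSet_windowCube : MeasurableSet (windowCube T) :=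
  measurableSet_Icc.prod (measurableSet_Icc.prod measurableSet_Icc)

/-- The displacements from a point `t` that stay in the window `[0, T]`. -/
def displacementWindow (T t : ℝ) : Set (ℝ × ℝ) := {τ | t + τ.1 ∈ Icc 0 T ∧ t + τ.2 ∈ Icc 0 T}

theorem measurableSet_displacementWindow (T t : ℝ) : MeasurableSet (displacementWindow T t) :=
  (measurableSet_Icc.preimage (f := fun τ : ℝ × ℝ => t + τ.1) (by fun_prop)).inter
    (measurableSet_Icc.preimage (f := fun τ : ℝ × ℝ => t + τ.2) (by fun_prop))

/-- The summand of the odd statistic, as a function of triples on the whole line. -/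
def oddSummand (T : ℝ) (g : ℝ × ℝ → ℝ) : ℝ × ℝ × ℝ → ℝ :=
  (windowCube T).indicator fun p => g (p.2.1 - p.1, p.2.2 - p.1)

theorem isStripTestFunction_oddSummand (hg : Measurable g) (hgb : ∃ B : ℝ, ∀ τ, |g τ| ≤ B) :
    IsStripTestFunction (oddSummand T g) := by
  obtain ⟨B, hB⟩ := hgb
  refine ⟨Measurable.indicator (by fun_prop) measurableSet_windowCube, ⟨B, fun p => ?_⟩,
    Icc 0 T, isCompact_Icc, fun p hp => indicator_of_notMem (fun h => hp h.1) _⟩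
  rw [← Real.norm_eq_abs]
  exact (norm_indicator_le_norm_self _ p).trans (hB _)

theorem oddSummand_reflect3 (hodd : ∀ τ, g (-τ) = -g τ) (p : ℝ × ℝ × ℝ) :
    oddSummand T g (reflect3 T p) = -oddSummand T g p := by
  have sub_mem_Icc (x : ℝ) : T - x ∈ Icc 0 T ↔ x ∈ Icc 0 T := by
    simp [mem_Icc, and_comm]
  have mem_windowCube_iff : reflect3 T p ∈ windowCube T ↔ p ∈ windowCube T := by
    simp only [reflect3, windowCube, mem_prod, Prod.map_fst, Prod.map_snd, sub_mem_Icc]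
  by_cases hp : p ∈ windowCube T
  · rw [oddSummand, indicator_of_mem (mem_windowCube_iff.2 hp), indicator_of_mem hp, ← hodd]
    simp [reflect3]
  · rw [oddSummand, indicator_of_notMem (mt mem_windowCube_iff.1 hp), indicator_of_notMem hp,
      neg_zero]

theorem oddStatistic_eq (μ : Measure ℝ) :
    oddStatistic T g μ =
      1 / T * sumDistinct (points μ) fun x : Fin 3 → ℝ => oddSummand T g (x 0, x 1, x 2) := by
  rw [oddStatistic, sumDistinct_inter]
  congr 2 with x
  have mem_windowCube_iff : (x 0, x 1, x 2) ∈ windowCube T ↔ ∀ i, x i ∈ Icc 0 T := by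
    simp only [windowCube, mem_prod, Fin.forall_fin_succ, Fin.succ_zero_eq_one,
      Fin.succ_one_eq_two, IsEmpty.forall_iff, and_true]
  by_cases hx : ∀ i, x i ∈ Icc 0 T
  · rw [oddSummand, indicator_of_mem (mem_windowCube_iff.2 hx)]
    exact indicator_of_mem (s := {x : Fin 3 → ℝ | ∀ i, x i ∈ Icc 0 T}) hx _
  · rw [oddSummand, indicator_of_notMem (mt mem_windowCube_iff.1 hx)]
    exact indicator_of_notMem (s := {x : Fin 3 → ℝ | ∀ i, x i ∈ Icc 0 T}) hx _

theorem integral_oddSummand_shear_mul (t : ℝ) :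
    ∫ τ, oddSummand T g (shear (t, τ)) * c τ =
      (Icc 0 T).indicator (fun t => ∫ τ in displacementWindow T t, g τ * c τ) t := by
  by_cases ht : t ∈ Icc 0 T
  · rw [indicator_of_mem ht, ← integral_indicator (measurableSet_displacementWindow T t)]
    congr 1 with τ
    have mem_windowCube_iff : shear (t, τ) ∈ windowCube T ↔ τ ∈ displacementWindow T t :=
      and_iff_right ht
    by_cases hτ : τ ∈ displacementWindow T t
    · rw [oddSummand, indicator_of_mem (mem_windowCube_iff.2 hτ), indicator_of_mem hτ]
      simp [shear]
    · rw [oddSummand, indicator_of_notMem (mt mem_windowCube_iff.1 hτ), indicator_of_notMem hτ,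
        zero_mul]
  · have notMem (τ : ℝ × ℝ) : shear (t, τ) ∉ windowCube T := fun h => ht h.1
    simp [oddSummand, notMem, ht]

theorem windowContrast_eq (c g : ℝ × ℝ → ℝ) (T : ℝ) :
    windowContrast c g T =
      1 / T * ∫ t in (0 : ℝ)..T, ∫ τ in displacementWindow T t, g τ * oddPart c τ := by
  simp only [windowContrast, ← integral_indicator (measurableSet_displacementWindow T _)]
  simp [displacementWindow, indicator_apply]

theorem integrable_oddPart (hc : Integrable c) : Integrable (oddPart c) :=
  (hc.sub hc.comp_neg).div_const 2

/-- In reduced coordinates the reflection of the three points is `(t, τ) ↦ (T - t, -τ)`, so the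
even part of `c` integrates to zero. -/
theorem IsStripTestFunction.integral_shear_mul_oddPart {F : ℝ × ℝ × ℝ → ℝ}
    (hF : IsStripTestFunction F) (hodd : ∀ p, F (reflect3 T p) = -F p) (hc : Integrable c) :
    ∫ q : ℝ × ℝ × ℝ, F (shear q) * oddPart c q.2 = ∫ q : ℝ × ℝ × ℝ, F (shear q) * c q.2 := by
  have integrable_even := hF.integrable_shear_mul (hc.sub (integrable_oddPart hc))
  have reflection : MeasurePreserving (Prod.map (T - ·) Neg.neg : ℝ × ℝ × ℝ → ℝ × ℝ × ℝ) :=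
    (Measure.measurePreserving_sub_left volume T).prod (Measure.measurePreserving_neg volume)
  have shear_reflection (q : ℝ × ℝ × ℝ) :
      shear (Prod.map (T - ·) Neg.neg q) = reflect3 T (shear q) := by
    ext <;> simp [shear, reflect3] <;> ring
  have even_integral : ∫ q : ℝ × ℝ × ℝ, F (shear q) * (c - oddPart c) q.2 = 0 := by
    refine integral_eq_zero_of_comp_eq_neg reflection integrable_even.aestronglyMeasurable
      fun q => ?_
    rw [shear_reflection, hodd]
    simp only [Pi.sub_apply, oddPart, Prod.map_snd, neg_neg]
    ring
  rw [← sub_eq_zero, ← neg_sub, neg_eq_zero, ← integral_sub (hF.integrable_shear_mul hc)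
    (hF.integrable_shear_mul (integrable_oddPart hc)), ← even_integral]
  simp only [Pi.sub_apply, mul_sub]

theorem windowContrast_eq_integral_oddSummand (hT : 0 ≤ T) (hc : Integrable c)
    (hg : Measurable g) (hgb : ∃ B : ℝ, ∀ τ, |g τ| ≤ B) (hodd : ∀ τ, g (-τ) = -g τ) :
    windowContrast c g T = 1 / T * ∫ q : ℝ × ℝ × ℝ, oddSummand T g (shear q) * c q.2 := by
  have hF := isStripTestFunction_oddSummand (T := T) hg hgb
  rw [← hF.integral_shear_mul_oddPart (oddSummand_reflect3 hodd) hc, Measure.volume_eq_prod,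
    integral_prod _ (hF.integrable_shear_mul (integrable_oddPart hc))]
  simp only [integral_oddSummand_shear_mul]
  rw [integral_indicator measurableSet_Icc, integral_Icc_eq_integral_Ioc,
    ← intervalIntegral.integral_of_le hT, windowContrast_eq]

theorem integrable_oddSummand_clusterMixed3 {ν : ℝ≥0} {Q : Measure (Measure ℝ)}
    [IsFiniteMeasure Q] {θ : ℝ} (h : ∫⁻ μ, (μ univ) ^ 3 ∂Q < ∞) (hg : Measurable g)
    (hgb : ∃ B : ℝ, ∀ τ, |g τ| ≤ B) :
    Integrable (oddSummand T g) (clusterMixed3 (markLaw ν Q θ) clusterKernel) := by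
  obtain ⟨B, hB⟩ := hgb
  have hwindow : IsTestFunction ((Icc 0 T).indicator (1 : ℝ → ℝ)) :=
    isTestFunction_indicator_one measurableSet_Icc isCompact_Icc subset_rfl
  have integrable_cube := (integral_clusterMixed3_mul (ρ := markLaw ν Q θ) (η := clusterKernel)
    (f := fun _ => (Icc 0 T).indicator 1) (fun _ => hwindow.measurable)
    (fun _ => hwindow.integrable_bind_clusterKernel h)
    fun _ _ => (hwindow.isStripTestFunction_mul hwindow.measurable hwindow.bounded).integrable
      (isStripFinite_clusterCumulant2_markLaw h)).1
  refine (integrable_cube.const_mul B).mono'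
    (isStripTestFunction_oddSummand hg ⟨B, hB⟩).measurable.aestronglyMeasurable
    (Eventually.of_forall fun p => ?_)
  rw [mul_assoc ((Icc 0 T).indicator 1 p.1), ← indicator_prod_one, ← indicator_prod_one]
  by_cases hp : p ∈ windowCube T
  · rw [oddSummand, indicator_of_mem hp, indicator_of_mem (by exact hp), Pi.one_apply, mul_one]
    exact hB _
  · rw [oddSummand, indicator_of_notMem hp, indicator_of_notMem (by exact hp), norm_zero, mul_zero]

end OddSummand

namespace IsSignedClusterFamily

variable {Ω : Type*} [MeasurableSpace Ω] {P : Measure Ω} [IsProbabilityMeasure P] {ν : ℝ≥0}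
  {Q : Measure (Measure ℝ)} {U : ℕ → Ω → ℝ} {C : ℕ → Ω → Measure ℝ} {S : ℝ → ℕ → Ω → ℝ}
  {θ : ℝ} {c : ℝ × ℝ → ℝ}

theorem integral_clusterCumulant3 (h : IsSignedClusterFamily P ν Q θ U C (S θ))
    (hc : IsReducedCumulantDensity3 P (signedClusterProcess U C S θ) c) {F : ℝ × ℝ × ℝ → ℝ}
    (hF : IsStripTestFunction F) :
    ∫ p, F p ∂clusterCumulant3 (markLaw ν Q θ) clusterKernel =
      ∫ q : ℝ × ℝ × ℝ, F (shear q) * c q.2 := by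
  have := h.isProbabilityMeasure_clusterLaw
  exact (isStripFinite_clusterCumulant3_markLaw
    h.thirdMoment).integral_eq_of_reducedDensity hc.integrable
      (fun f hf => (h.factorialCumulant3_eq hf).symm.trans (hc.disintegration f hf)) hF

theorem integrable_oddStatistic_and_integral_eq (h : IsSignedClusterFamily P ν Q θ U C (S θ))
    (hθ : θ ∈ Icc (-1 : ℝ) 1) (h₁ : IsSignedClusterFamily P ν Q 1 U C (S 1))
    (hc : IsReducedCumulantDensity3 P (signedClusterProcess U C S 1) c) {g : ℝ × ℝ → ℝ}
    (hg : Measurable g) (hgb : ∃ B : ℝ, ∀ τ, |g τ| ≤ B) (hodd : ∀ τ, g (-τ) = -g τ) {T : ℝ}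
    (hT : 0 ≤ T) :
    Integrable (fun ω => oddStatistic T g (signedClusterProcess U C S θ ω)) P ∧
      ∫ ω, oddStatistic T g (signedClusterProcess U C S θ ω) ∂P = θ * windowContrast c g T := by
  have := h.isProbabilityMeasure_clusterLaw
  have h3 := h.thirdMoment
  have hF := isStripTestFunction_oddSummand (T := T) hg hgb
  have integrable_cumulant (θ : ℝ) := hF.integrable
    (isStripFinite_clusterCumulant3_markLaw (ν := ν) (θ := θ) h3)
  have integrable_mixed :=
    integrable_oddSummand_clusterMixed3 (T := T) (ν := ν) (θ := θ) h3 hg hgb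
  obtain ⟨integrable_sum, integral_sum⟩ :=
    h.isFactorialMomentMeasure_three.integrable_sumDistinct_and_integral_eq_of_map
      (f := fun x => oddSummand T g (x 0, x 1, x 2)) (by fun_prop)
      (hF.measurable.comp (by fun_prop)) ((integrable_cumulant θ).add_measure integrable_mixed)
  simp only [oddStatistic_eq]
  refine ⟨integrable_sum.const_mul _, ?_⟩
  calc ∫ ω, 1 / T * sumDistinct (points (signedClusterProcess U C S θ ω))
          (fun x => oddSummand T g (x 0, x 1, x 2)) ∂P
      = 1 / T * (∫ p, oddSummand T g p ∂clusterCumulant3 (markLaw ν Q θ) clusterKernel +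
          ∫ p, oddSummand T g p ∂clusterMixed3 (markLaw ν Q θ) clusterKernel) := by
        rw [integral_const_mul, integral_sum]
        exact congrArg _ (integral_add_measure (integrable_cumulant θ) integrable_mixed)
    _ = 1 / T * ∫ p, oddSummand T g p ∂clusterCumulant3 (markLaw ν Q θ) clusterKernel := by
        rw [integral_eq_zero_of_comp_eq_neg (measurePreserving_reflect3_clusterMixed3 ν Q θ T)
          hF.measurable.aestronglyMeasurable (oddSummand_reflect3 hodd), add_zero]
    _ = 1 / T * (θ * ∫ q : ℝ × ℝ × ℝ, oddSummand T g (shear q) * c q.2) := by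
        rw [integral_clusterCumulant3_markLaw hθ hF.measurable (oddSummand_reflect3 hodd)
          (integrable_cumulant 1), h₁.integral_clusterCumulant3 hc hF]
    _ = θ * windowContrast c g T := by
        rw [windowContrast_eq_integral_oddSummand hT hc.integrable hg hgb hodd]
        ring

end IsSignedClusterFamily

/-! ### The large-window limit -/

section Limit

theorem norm_setIntegral_sub_integral_le {α E : Type*} [MeasurableSpace α] {μ : Measure α}
    [NormedAddCommGroup E] [NormedSpace ℝ E] {f : α → E} (hf : Integrable f μ) {s : Set α}
    (hs : MeasurableSet s) : ‖∫ x in s, f x ∂μ - ∫ x, f x ∂μ‖ ≤ ∫ x, ‖f x‖ ∂μ := by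
  rw [← integral_add_compl hs hf, sub_add_cancel_left, norm_neg]
  exact (norm_integral_le_integral_norm _).trans
    (setIntegral_le_integral hf.norm (Eventually.of_forall fun x => norm_nonneg _))

theorem norm_intervalIntegral_le_of_eq_zero_on_middle {E : Type*} [NormedAddCommGroup E]
    [NormedSpace ℝ E] {D : ℝ → E} {K R T : ℝ} (hR : 0 < R) (hT : 2 * R ≤ T)
    (hK : ∀ t, ‖D t‖ ≤ K) (hD : ∀ t ∈ Icc R (T - R), D t = 0) :
    ‖∫ t in (0 : ℝ)..T, D t‖ ≤ K * (2 * R) := by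
  have middle_subset : Icc R (T - R) ⊆ Ioc 0 T := Icc_subset_Ioc hR (by linarith)
  have boundary_volume : volume.real (Ioc 0 T \ Icc R (T - R)) = 2 * R := by
    rw [measureReal_sdiff middle_subset measurableSet_Icc
      measure_Ioc_lt_top.ne, Real.volume_real_Ioc_of_le (by linarith),
      Real.volume_real_Icc_of_le (by linarith)]
    ring
  rw [intervalIntegral.integral_of_le (by linarith), ← boundary_volume,
    setIntegral_eq_of_subset_of_forall_sdiff_eq_zero measurableSet_Ioc sdiff_subset
      fun t ht => hD t (by_contra fun h => ht.2 ⟨ht.1, h⟩)]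
  exact norm_setIntegral_le_of_norm_le_const
    ((measure_mono sdiff_subset).trans_lt measure_Ioc_lt_top) fun t _ => hK t

theorem mem_displacementWindow_of_norm_le {R T t : ℝ} (ht : t ∈ Icc R (T - R)) {τ : ℝ × ℝ}
    (hτ : ‖τ‖ ≤ R) : τ ∈ displacementWindow T t := by
  have hfst := abs_le.1 ((norm_fst_le τ).trans hτ)
  have hsnd := abs_le.1 ((norm_snd_le τ).trans hτ)
  exact ⟨⟨by linarith [ht.1, hfst.1], by linarith [ht.2, hfst.2]⟩,
    by linarith [ht.1, hsnd.1], by linarith [ht.2, hsnd.2]⟩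

variable {c g : ℝ × ℝ → ℝ}

theorem integrable_bounded_mul (hg : Measurable g) (hgb : ∃ B : ℝ, ∀ τ, |g τ| ≤ B)
    (hc : Integrable c) : Integrable fun τ => g τ * c τ := by
  obtain ⟨B, hB⟩ := hgb
  exact hc.bdd_mul hg.aestronglyMeasurable (Eventually.of_forall hB)

theorem intervalIntegrable_setIntegral_displacementWindow {T : ℝ} (hT : 0 ≤ T)
    (hg : Measurable g) (hgb : ∃ B : ℝ, ∀ τ, |g τ| ≤ B) (hc : Integrable c) :
    IntervalIntegrable (fun t => ∫ τ in displacementWindow T t, g τ * c τ) volume 0 T := by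
  rw [intervalIntegrable_iff_integrableOn_Icc_of_le hT,
    ← integrable_indicator_iff measurableSet_Icc]
  refine (((isStripTestFunction_oddSummand (T := T) hg hgb).integrable_shear_mul
    hc).integral_prod_left).congr (Eventually.of_forall fun t => ?_)
  exact integral_oddSummand_shear_mul t

theorem windowContrast_sub_limitContrast_isBigO (hc : Integrable c) (hg : IsTestFunction g) :
    (fun T => windowContrast c g T - limitContrast c g) =O[atTop] fun T : ℝ => T⁻¹ := by
  obtain ⟨R, hR, hgR⟩ := hg.compactSupport.isCompact.isBounded.exists_pos_norm_le
  have ho := integrable_oddPart hc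
  have integrable_limit := integrable_bounded_mul hg.measurable hg.bounded ho
  refine IsBigO.of_bound ((∫ τ, ‖g τ * oddPart c τ‖) * (2 * R)) ?_
  filter_upwards [eventually_ge_atTop (2 * R)] with T hT
  have hT0 : 0 < T := by linarith
  have eq_on_middle : ∀ t ∈ Icc R (T - R),
      (∫ τ in displacementWindow T t, g τ * oddPart c τ) - limitContrast c g = 0 := by
    intro t ht
    refine sub_eq_zero.2 (setIntegral_eq_integral_of_forall_compl_eq_zero fun τ hτ => ?_)
    have notMem_tsupport : τ ∉ tsupport g := fun h =>
      hτ (mem_displacementWindow_of_norm_le ht (hgR τ h))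
    rw [image_eq_zero_of_notMem_tsupport notMem_tsupport, zero_mul]
  have difference : windowContrast c g T - limitContrast c g = T⁻¹ * ∫ t in (0 : ℝ)..T,
      ((∫ τ in displacementWindow T t, g τ * oddPart c τ) - limitContrast c g) := by
    rw [intervalIntegral.integral_sub
      (intervalIntegrable_setIntegral_displacementWindow hT0.le hg.measurable hg.bounded ho)
      intervalIntegrable_const,
      intervalIntegral.integral_const, windowContrast_eq, smul_eq_mul, sub_zero, mul_sub,
      inv_mul_cancel_left₀ hT0.ne', one_div]
  rw [difference, norm_mul, mul_comm]
  gcongr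
  exact norm_intervalIntegral_le_of_eq_zero_on_middle hR hT
    (fun t => norm_setIntegral_sub_integral_le integrable_limit
      (measurableSet_displacementWindow T t)) eq_on_middle

end Limit

/-! ### The bispectral form of the limiting contrast -/

section FourierInversion

open scoped FourierTransform SchwartzMap

variable {V : Type*} [NormedAddCommGroup V] [InnerProductSpace ℝ V] [MeasurableSpace V]
  [BorelSpace V] [FiniteDimensional ℝ V] {f h : V → ℂ}

theorem integral_fourier_mul_eq (hf : Integrable f) (hh : Integrable h) :
    ∫ x, 𝓕 f x * h x = ∫ x, f x * 𝓕 h x := by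
  have flip_eq := VectorFourier.integral_fourierIntegral_smul_eq_flip (L := innerₗ V)
    Real.continuous_fourierChar continuous_inner hf hh
  rwa [flip_innerₗ] at flip_eq

theorem integral_fourierInv_mul_eq (hf : Integrable f) (hh : Integrable h) :
    ∫ x, 𝓕⁻ f x * h x = ∫ x, f x * 𝓕⁻ h x := by
  calc ∫ x, 𝓕⁻ f x * h x = ∫ x, 𝓕 f x * h (-x) := by
        rw [← integral_neg_eq_self]
        simp only [Real.fourierInv_eq_fourier_neg, neg_neg]
    _ = ∫ x, f x * 𝓕⁻ h x := by
        rw [Real.fourierInv_eq_fourier_comp_neg]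
        exact integral_fourier_mul_eq hf hh.comp_neg

theorem continuous_fourierInv (hf : Integrable f) : Continuous (𝓕⁻ f) := by
  rw [Real.fourierInv_eq_fourier_comp_neg]
  exact VectorFourier.fourierIntegral_continuous Real.continuous_fourierChar continuous_inner
    hf.comp_neg

theorem norm_fourierInv_le (f : V → ℂ) (w : V) : ‖𝓕⁻ f w‖ ≤ ∫ v, ‖f v‖ := by
  rw [Real.fourierInv_eq_fourier_neg]
  exact VectorFourier.norm_fourierIntegral_le_integral_norm _ _ _ _ _

/-- Moving both transforms onto a smooth test function reduces the claim to Schwartz inversion,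
so `f` need not be continuous. -/
theorem fourierInv_fourier_ae_eq (hf : Integrable f) (hf' : Integrable (𝓕 f)) :
    𝓕⁻ (𝓕 f) =ᵐ[volume] f := by
  refine ae_eq_of_integral_contDiff_smul_eq
    (continuous_fourierInv hf').locallyIntegrable hf.locallyIntegrable fun φ hφ hφc => ?_
  have hφc_ofReal : HasCompactSupport fun x => (φ x : ℂ) :=
    hφc.comp_left (g := Complex.ofReal) Complex.ofReal_zero
  let Φ : 𝓢(V, ℂ) := hφc_ofReal.toSchwartzMap (Complex.ofRealCLM.contDiff.comp hφ)
  have smul_eq_mul_schwartz (u : V → ℂ) : (fun x => φ x • u x) = fun x => u x * Φ x := by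
    ext x
    rw [Complex.real_smul, mul_comm]
    rfl
  calc ∫ x, φ x • 𝓕⁻ (𝓕 f) x = ∫ x, 𝓕⁻ (𝓕 f) x * Φ x := by rw [smul_eq_mul_schwartz]
    _ = ∫ x, 𝓕 f x * (𝓕⁻ Φ) x := by
        rw [integral_fourierInv_mul_eq hf' Φ.integrable, SchwartzMap.fourierInv_coe]
    _ = ∫ x, f x * Φ x := by
        rw [integral_fourier_mul_eq hf (𝓕⁻ Φ).integrable, ← SchwartzMap.fourier_coe,
          FourierTransform.fourier_fourierInv_eq]
    _ = ∫ x, φ x • f x := by rw [smul_eq_mul_schwartz]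

theorem integral_mul_eq_integral_fourier_mul_fourierInv (hf : Integrable f)
    (hf' : Integrable (𝓕 f)) (hh : Integrable h) :
    ∫ x, f x * h x = ∫ w, 𝓕 f w * 𝓕⁻ h w := by
  rw [← integral_fourierInv_mul_eq hf' hh]
  exact integral_congr_ae ((fourierInv_fourier_ae_eq hf hf').symm.mul .rfl)

theorem integrable_fourier_mul_fourierInv (hf' : Integrable (𝓕 f)) (hh : Integrable h) :
    Integrable fun w => 𝓕 f w * 𝓕⁻ h w :=
  hf'.mul_bdd (continuous_fourierInv hh).aestronglyMeasurable
    (Eventually.of_forall (norm_fourierInv_le h))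

end FourierInversion

section Bispectrum

open scoped FourierTransform ComplexConjugate

/-- A real function on the plane as a complex function on the Euclidean plane: the library's
Fourier transform needs an inner product space, and the product norm on `ℝ × ℝ` is not one. -/
def euclideanLift (f : ℝ × ℝ → ℝ) (x : WithLp 2 (ℝ × ℝ)) : ℂ := (f (WithLp.ofLp x) : ℂ)

variable {c f g H : ℝ × ℝ → ℝ}

theorem integral_comp_ofLp {E : Type*} [NormedAddCommGroup E] [NormedSpace ℝ E]
    (F : ℝ × ℝ → E) : ∫ x : WithLp 2 (ℝ × ℝ), F (WithLp.ofLp x) = ∫ τ, F τ :=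
  (WithLp.volume_preserving_symm_measurableEquiv_toLp_prod ℝ ℝ).integral_comp' F

theorem integrable_euclideanLift (hf : Integrable f) : Integrable (euclideanLift f) :=
  (WithLp.volume_preserving_ofLp ℝ ℝ).integrable_comp_of_integrable hf.ofReal

theorem fourier_euclideanLift (f : ℝ × ℝ → ℝ) (w : WithLp 2 (ℝ × ℝ)) :
    𝓕 (euclideanLift f) w = planeFourier f ((2 * Real.pi) • WithLp.ofLp w) := by
  rw [Real.fourier_eq', planeFourier, ← integral_comp_ofLp]
  congr 1 with x
  rw [euclideanLift, smul_eq_mul]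
  congr 2
  simp only [WithLp.prod_inner_apply, RCLike.inner_apply, conj_trivial, Prod.smul_fst,
    Prod.smul_snd, smul_eq_mul]
  push_cast
  ring

theorem planeFourier_neg (f : ℝ × ℝ → ℝ) (ω : ℝ × ℝ) :
    planeFourier f (-ω) = conj (planeFourier f ω) := by
  rw [planeFourier, planeFourier, ← integral_conj]
  congr 1 with τ
  rw [map_mul, ← Complex.exp_conj, Complex.conj_ofReal, map_mul, map_neg, Complex.conj_I,
    Complex.conj_ofReal]
  congr 2
  push_cast [Prod.fst_neg, Prod.snd_neg]
  ring

theorem fourierInv_euclideanLift (f : ℝ × ℝ → ℝ) (w : WithLp 2 (ℝ × ℝ)) :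
    𝓕⁻ (euclideanLift f) w = conj (planeFourier f ((2 * Real.pi) • WithLp.ofLp w)) := by
  rw [Real.fourierInv_eq_fourier_neg, fourier_euclideanLift, ← planeFourier_neg,
    WithLp.ofLp_neg, smul_neg]

theorem integral_euclideanLift_mul (f h : ℝ × ℝ → ℝ) :
    ∫ x, euclideanLift f x * euclideanLift h x = ((∫ τ, f τ * h τ : ℝ) : ℂ) := by
  rw [← integral_complex_ofReal, ← integral_comp_ofLp]
  simp only [euclideanLift, Complex.ofReal_mul]

theorem integrable_fourier_euclideanLift
    (hgH : ∀ ω, planeFourier g ω = Complex.I * (H ω : ℂ)) (hH : Integrable H) :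
    Integrable (𝓕 (euclideanLift g)) := by
  have integrable_scaled : Integrable fun ω => H ((2 * Real.pi) • ω) :=
    (integrable_comp_smul_iff volume H (by positivity)).2 hH
  refine ((integrable_euclideanLift integrable_scaled).const_mul Complex.I).congr
    (Eventually.of_forall fun w => ?_)
  rw [fourier_euclideanLift, hgH]
  rfl

theorem re_fourier_mul_fourierInv_euclideanLift
    (hgH : ∀ ω, planeFourier g ω = Complex.I * (H ω : ℂ)) (w : WithLp 2 (ℝ × ℝ)) :
    (𝓕 (euclideanLift g) w * 𝓕⁻ (euclideanLift c) w).re =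
      H ((2 * Real.pi) • WithLp.ofLp w) *
        (planeFourier c ((2 * Real.pi) • WithLp.ofLp w)).im := by
  rw [fourier_euclideanLift, fourierInv_euclideanLift, hgH]
  simp

theorem integral_mul_eq_bispectrum (hg : Integrable g) (hc : Integrable c)
    (hgH : ∀ ω, planeFourier g ω = Complex.I * (H ω : ℂ)) (hH : Integrable H) :
    ∫ τ, g τ * c τ =
      1 / (2 * Real.pi) ^ 2 * ∫ ω : ℝ × ℝ, H ω * (planeFourier c ω).im := by
  have integrable_fourier := integrable_fourier_euclideanLift hgH hH
  have hcE := integrable_euclideanLift hc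
  calc ∫ τ, g τ * c τ
      = (∫ w, 𝓕 (euclideanLift g) w * 𝓕⁻ (euclideanLift c) w).re := by
        rw [← integral_mul_eq_integral_fourier_mul_fourierInv (integrable_euclideanLift hg)
          integrable_fourier hcE, integral_euclideanLift_mul, Complex.ofReal_re]
    _ = ∫ w, (𝓕 (euclideanLift g) w * 𝓕⁻ (euclideanLift c) w).re :=
        (integral_re (integrable_fourier_mul_fourierInv integrable_fourier hcE)).symm
    _ = ∫ ω : ℝ × ℝ, H ((2 * Real.pi) • ω) * (planeFourier c ((2 * Real.pi) • ω)).im := by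
        simp only [re_fourier_mul_fourierInv_euclideanLift hgH]
        exact integral_comp_ofLp fun ω =>
          H ((2 * Real.pi) • ω) * (planeFourier c ((2 * Real.pi) • ω)).im
    _ = 1 / (2 * Real.pi) ^ 2 * ∫ ω : ℝ × ℝ, H ω * (planeFourier c ω).im := by
        rw [Measure.integral_comp_smul_of_nonneg _ (fun ω => H ω * (planeFourier c ω).im) _
          (hR := by positivity)]
        simp

theorem limitContrast_eq_integral_mul (hc : Integrable c) (hg : Measurable g)
    (hgb : ∃ B : ℝ, ∀ τ, |g τ| ≤ B) (hodd : ∀ τ, g (-τ) = -g τ) :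
    limitContrast c g = ∫ τ, g τ * c τ := by
  have integral_mul_comp_neg : ∫ τ, g τ * c (-τ) = -∫ τ, g τ * c τ := by
    rw [← integral_neg_eq_self, ← integral_neg]
    simp only [hodd, neg_neg, neg_mul]
  calc limitContrast c g = ∫ τ, (g τ * c τ - g τ * c (-τ)) / 2 := by
        simp only [limitContrast, oddPart, ← mul_sub, ← mul_div_assoc]
    _ = ∫ τ, g τ * c τ := by
        rw [integral_div, integral_sub (integrable_bounded_mul hg hgb hc)
          (integrable_bounded_mul hg hgb hc.comp_neg), integral_mul_comp_neg]
        ring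

theorem limitContrast_eq_bispectrum (hc : Integrable c) (hg : Integrable g)
    (hgm : Measurable g) (hgb : ∃ B : ℝ, ∀ τ, |g τ| ≤ B) (hodd : ∀ τ, g (-τ) = -g τ)
    (hgH : ∀ ω, planeFourier g ω = Complex.I * (H ω : ℂ)) (hH : Integrable H) :
    limitContrast c g =
      1 / (2 * Real.pi) ^ 2 * ∫ ω : ℝ × ℝ, H ω * (planeFourier c ω).im :=
  (limitContrast_eq_integral_mul hc hgm hgb hodd).trans
    (integral_mul_eq_bispectrum hg hc hgH hH)

end Bispectrum

end ClusterContrast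

end

open ClusterContrast in
theorem mainTheorem6_general {Ω : Type*} [MeasurableSpace Ω] {P : Measure Ω}
    [IsProbabilityMeasure P] {ν : ℝ≥0} {Q : Measure (Measure ℝ)} {U : ℕ → Ω → ℝ}
    {C : ℕ → Ω → Measure ℝ} {S : ℝ → ℕ → Ω → ℝ}
    (hfam : ∀ θ ∈ Icc (-1 : ℝ) 1, IsSignedClusterFamily P ν Q θ U C (S θ)) {c : ℝ × ℝ → ℝ}
    (hc : IsReducedCumulantDensity3 P (signedClusterProcess U C S 1) c) {g : ℝ × ℝ → ℝ}
    (hg : Measurable g) (hgb : ∃ B : ℝ, ∀ τ, |g τ| ≤ B) (hodd : ∀ τ, g (-τ) = -g τ) :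
    (∀ T : ℝ, 0 < T → ∀ θ ∈ Icc (-1 : ℝ) 1,
      Integrable (fun ω => oddStatistic T g (signedClusterProcess U C S θ ω)) P ∧
      ∫ ω, oddStatistic T g (signedClusterProcess U C S θ ω) ∂P = θ * windowContrast c g T) ∧
    (HasCompactSupport g →
      (fun T : ℝ => windowContrast c g T - limitContrast c g) =O[atTop] fun T : ℝ => T⁻¹) ∧
    (Integrable g → ∀ H : ℝ × ℝ → ℝ,
      (∀ ω, planeFourier g ω = Complex.I * (H ω : ℂ)) → Integrable H →
      limitContrast c g =
        1 / (2 * Real.pi) ^ 2 * ∫ ω : ℝ × ℝ, H ω * (planeFourier c ω).im) :=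
  ⟨fun _ hT _ hθ => (hfam _ hθ).integrable_oddStatistic_and_integral_eq hθ
      (hfam 1 (right_mem_Icc.2 (by norm_num))) hc hg hgb hodd hT.le,
    fun hgc => windowContrast_sub_limitContrast_isBigO hc.integrable ⟨hg, hgb, hgc⟩,
    fun hgi _ hgH hH => limitContrast_eq_bispectrum hc.integrable hgi hg hgb hodd hgH hH⟩

theorem mainTheorem6 {Ω : Type*} [MeasurableSpace Ω] (P : Measure Ω) [IsProbabilityMeasure P]
    (ν : ℝ≥0) (Q : Measure (Measure ℝ)) (U : ℕ → Ω → ℝ) (C : ℕ → Ω → Measure ℝ)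
    (S : ℝ → ℕ → Ω → ℝ)
    (hfam : ClusterContrast.IsSignSymmetrizedFamily P ν Q U C S)
    (c : ℝ × ℝ → ℝ)
    (hc : ClusterContrast.IsReducedCumulantDensity3 P
      (ClusterContrast.signedClusterProcess U C S 1) c)
    (g : ℝ × ℝ → ℝ) (hg : ClusterContrast.IsTestFunction g) (hodd : ∀ τ, g (-τ) = -g τ) :
    (∀ T : ℝ, 0 < T → ∀ θ ∈ Icc (-1 : ℝ) 1,
      Integrable (fun ω => ClusterContrast.oddStatistic T g
        (ClusterContrast.signedClusterProcess U C S θ ω)) P ∧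
      ∫ ω, ClusterContrast.oddStatistic T g
        (ClusterContrast.signedClusterProcess U C S θ ω) ∂P =
          θ * ClusterContrast.windowContrast c g T) ∧
    ((fun T : ℝ => ClusterContrast.windowContrast c g T - ClusterContrast.limitContrast c g)
      =O[atTop] fun T : ℝ => T⁻¹) ∧
    (∀ Hg : ℝ × ℝ → ℝ,
      (∀ ω, ClusterContrast.planeFourier g ω = Complex.I * (Hg ω : ℂ)) → Integrable Hg →
      ClusterContrast.limitContrast c g =
        1 / (2 * Real.pi) ^ 2 *
          ∫ ω : ℝ × ℝ, Hg ω * (ClusterContrast.planeFourier c ω).im) :=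
  have ⟨mean_eq, rate, bispectrum⟩ := mainTheorem6_general
    (fun _ hθ => hfam.isSignedClusterFamily hθ) hc hg.measurable hg.bounded hodd
  ⟨mean_eq, rate hg.compactSupport, bispectrum (hg.integrable volume)⟩
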